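/- Let $n\in\mathbb N$ and $\ell>0$. An $n$-dimensional charge is a $\sigma$-additive function $\mu=(\mu_1,\dots,\mu_n)$ from the Borel sets of $\mathbb R^n$ to $\mathbb R^n$; it acts on bounded measurable vector fields by $\langle\mu,\varphi\rangle=\sum_k\int\varphi_k\,d\mu_k$, $\|\mu\|$ denotes its variation measure (with respect to the Euclidean norm), $\operatorname{Var}(\mu)=\|\mu\|(\mathbb R^n)$, and $\operatorname{supp}(\mu)$ is the support of $\|\mu\|$. The charge is divergence free, $\operatorname{Div}(\mu)=0$, if $\langle\mu,\nabla\psi\rangle=0$ for all $\psi\in C_c^\infty(\mathbb R^n)$. Let $K_\ell$ be the set of Lipschitz curves $\gamma:[0,\ell]\to\mathbb R^n$ with $|\dot\gamma|\le 1$ almost everywhere, with the topology of uniform convergence and its Borel $\sigma$-algebra. For $\gamma\in K_\ell$ let $L(\gamma)=\int_0^\ell|\dot\gamma(t)|\,dt$, and let $[\gamma]$ be the charge $[\gamma](A)=\int_{\{t\in[0,\ell]:\gamma(t)\in A\}}\dot\gamma(t)\,dt$, so that $\langle[\gamma],\varphi\rangle=\int_0^\ell\langle\varphi(\gamma(t)),\dot\gamma(t)\rangle\,dt$.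 **Proposition.** For every $\ell>0$ and every $n$-dimensional charge $\mu$ with $\operatorname{Div}(\mu)=0$ there is a finite positive Borel measure $\nu$ on $K_\ell$ which has all of the following properties: 1. $\mu=\int_{K_\ell}[\gamma]\,d\nu(\gamma)$, i.e. $\gamma\mapsto\langle[\gamma],\varphi\rangle$ is $\nu$-integrable and $\langle\mu,\varphi\rangle=\int_{K_\ell}\langle[\gamma],\varphi\rangle\,d\nu(\gamma)$ for every continuous compactly supported field $\varphi:\mathbb R^n\to\mathbb R^n$; 2. $\|\mu\|=\int_{K_\ell}\|[\gamma]\|\,d\nu(\gamma)$; 3. $\nu$-almost every $\gamma\in K_\ell$ has all its values in $\operatorname{supp}(\mu)$ and satisfies $\operatorname{Var}([\gamma])=L(\gamma)=\ell$; 4. $\|\mu\|=\ell\int_{K_\ell}\delta_{\gamma(0)}\,d\nu(\gamma)=\ell\int_{K_\ell}\delta_{\gamma(\ell)}\,d\nu(\gamma)$. Here the identities between positive measures in 2 and 4 mean equality on every Borel set $E\subseteq\mathbb R^n$, the integrands ($\|[\gamma]\|(E)$, resp. $\delta_{\gamma(0)}(E)$ and $\delta_{\gamma(\ell)}(E)$)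 being $\nu$-measurable functions of $\gamma$. -/

import Mathlib

open MeasureTheory
open scoped ContDiff ENNReal NNReal

noncomputable section

/-- An `n`-dimensional charge: a `σ`-additive function from the Borel sets of `ℝⁿ` to `ℝⁿ`. Its
variation measure is `VectorMeasure.variation`. -/
abbrev Charge (n : ℕ) : Type :=
  VectorMeasure (EuclideanSpace ℝ (Fin n)) (EuclideanSpace ℝ (Fin n))

/-- The action `⟨μ, φ⟩ = ∑ₖ ∫ φₖ dμₖ` of a charge on a vector field: the integral of `φ` against
the vector measure `μ`, paired through the Euclidean scalar product. -/
def Charge.act {n : ℕ} (μ : Charge n)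
    (φ : EuclideanSpace ℝ (Fin n) → EuclideanSpace ℝ (Fin n)) : ℝ :=
  VectorMeasure.integral μ φ (innerSL ℝ)

/-- The distributional divergence `⟨Div μ, ψ⟩ = -⟨μ, ∇ψ⟩`. -/
def Charge.div {n : ℕ} (μ : Charge n) (ψ : EuclideanSpace ℝ (Fin n) → ℝ) : ℝ :=
  - μ.act (gradient ψ)

/-- `Div μ = 0` as a distribution. -/
def Charge.DivergenceFree {n : ℕ} (μ : Charge n) : Prop :=
  ∀ ψ : EuclideanSpace ℝ (Fin n) → ℝ, ContDiff ℝ ∞ ψ → HasCompactSupport ψ → μ.div ψ = 0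

/-- The support of a charge, i.e. of its variation measure. -/
def Charge.supp {n : ℕ} (μ : Charge n) : Set (EuclideanSpace ℝ (Fin n)) :=
  μ.variation.support

section Curves

variable {n : ℕ} {ℓ : ℝ} (hℓ : 0 < ℓ)

/-- The Borel `σ`-algebra of the uniform norm on `C([0, ℓ], ℝⁿ)`; subsets of this space carry the
induced topology and `σ`-algebra. -/
instance instMeasurableSpaceCurves :
    MeasurableSpace C(Set.Icc (0 : ℝ) ℓ, EuclideanSpace ℝ (Fin n)) :=
  borel _

instance instBorelSpaceCurves : BorelSpace C(Set.Icc (0 : ℝ) ℓ, EuclideanSpace ℝ (Fin n)) :=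
  ⟨rfl⟩

/-- The curve `γ`, continued by constants to the real line. -/
def curveExt (γ : C(Set.Icc (0 : ℝ) ℓ, EuclideanSpace ℝ (Fin n))) :
    ℝ → EuclideanSpace ℝ (Fin n) :=
  Set.IccExtend hℓ.le γ

/-- The derivative of `γ`; only its values at points of differentiability in `(0, ℓ)` matter. -/
def velocity (γ : C(Set.Icc (0 : ℝ) ℓ, EuclideanSpace ℝ (Fin n))) :
    ℝ → EuclideanSpace ℝ (Fin n) :=
  deriv (curveExt hℓ γ)

variable (n) in
/-- The set `K_ℓ` of Lipschitz curves `γ : [0, ℓ] → ℝⁿ` with `|γ'| ≤ 1` almost everywhere. -/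
def lipCurves : Set C(Set.Icc (0 : ℝ) ℓ, EuclideanSpace ℝ (Fin n)) :=
  {γ | (∃ C : ℝ≥0, LipschitzWith C γ) ∧
    ∀ᵐ t ∂(volume.restrict (Set.Icc 0 ℓ)), ‖velocity hℓ γ t‖ ≤ 1}

/-- The charge `[γ]`: the push-forward under `γ` of the vector measure `γ' · λ¹` on `[0, ℓ]`. -/
def curveCharge (γ : C(Set.Icc (0 : ℝ) ℓ, EuclideanSpace ℝ (Fin n))) : Charge n :=
  ((volume.restrict (Set.Icc 0 ℓ)).withDensityᵥ (velocity hℓ γ)).map (curveExt hℓ γ)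

/-- The length `L(γ) = ∫ |γ'| dλ¹`. -/
def curveLength (γ : C(Set.Icc (0 : ℝ) ℓ, EuclideanSpace ℝ (Fin n))) : ℝ≥0∞ :=
  ∫⁻ t in Set.Icc 0 ℓ, ‖velocity hℓ γ t‖ₑ

/-- `μ = ∫ [γ] dν(γ)` in the weak sense: `⟨μ, φ⟩ = ∫ ⟨[γ], φ⟩ dν(γ)` for all continuous compactly
supported fields `φ`. -/
def IsChargeIntegral (μ : Charge n) (ν : Measure (lipCurves n hℓ)) : Prop :=
  ∀ φ : EuclideanSpace ℝ (Fin n) → EuclideanSpace ℝ (Fin n),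
    Continuous φ → HasCompactSupport φ →
      Integrable (fun γ : lipCurves n hℓ => (curveCharge hℓ γ.1).act φ) ν ∧
        μ.act φ = ∫ γ : lipCurves n hℓ, (curveCharge hℓ γ.1).act φ ∂ν

end Curves

/-- `ρ = ∫ κ_γ dν(γ)` for positive measures: `ρ(E) = ∫ κ_γ(E) dν(γ)` for all measurable `E`. -/
def IsMeasureIntegral {X Y : Type*} [MeasurableSpace X] [MeasurableSpace Y]
    (ρ : Measure X) (κ : Y → Measure X) (ν : Measure Y) : Prop :=
  ∀ E : Set X, MeasurableSet E →
    AEMeasurable (fun y => κ y E) ν ∧ ρ E = ∫⁻ y, κ y E ∂ν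

end

/-!
Let `μ = b ‖μ‖` be the polar decomposition, with `‖b‖ = 1` almost everywhere, and `ρ = ‖μ‖ / ℓ`.
Mollify `b ρ` and `ρ` with the same positive kernel, whose logarithm is Lipschitz. The quotient of
the mollified measures is then a globally Lipschitz field, bounded by `1` because `b` is, and it is
divergence free with respect to the mollification of `ρ`, so its flow preserves that measure. The
flow lines on `[0, ℓ]`, started according to the mollified measure, form a measure on curves with
the same marginal at every time. These measures are tight. A limit `ζ` has all marginals equal to
`ρ`, and it is concentrated on the solutions of `γ' = b(γ)`: the mean defect in this equation is
bounded by the mean distance between the vector field and any continuous field, hence it vanishes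
in the limit by density of the continuous fields in `L¹`.

By stationarity the time that `γ` spends in a set, averaged over `ζ`, is `ℓ ρ = ‖μ‖`. Along a
solution, `[γ]` has density `b` with respect to the occupation measure of `γ`. As `b` is a unit
field depending on the position only, pieces of `γ` through the same point cannot cancel, so the
occupation measure is the variation of `[γ]`.
-/

section VectorMeasures

variable {X E F G : Type*} [MeasurableSpace X] [NormedAddCommGroup E] [NormedSpace ℝ E]
  [NormedAddCommGroup F] [NormedSpace ℝ F] [NormedAddCommGroup G] [NormedSpace ℝ G]

section Polar

variable [FiniteDimensional ℝ F]

/-- The `i`-th coordinate of a vector measure with values in a finite-dimensional space, in the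
basis `Module.finBasis ℝ F`. -/
noncomputable def vectorMeasureCoord (μ : VectorMeasure X F)
    (i : Fin (Module.finrank ℝ F)) : SignedMeasure X :=
  μ.mapRange ((Module.finBasis ℝ F).coord i).toAddMonoidHom
    ((Module.finBasis ℝ F).coord i).continuous_of_finiteDimensional

theorem sum_vectorMeasureCoord_smul (μ : VectorMeasure X F) (A : Set X) :
    ∑ i, vectorMeasureCoord μ i A • Module.finBasis ℝ F i = μ A :=
  (Module.finBasis ℝ F).sum_repr (μ A)

instance isFiniteMeasure_variation (μ : VectorMeasure X F) : IsFiniteMeasure μ.variation := by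
  set e := Module.finBasis ℝ F
  have hle : μ.variation ≤ ∑ i, ‖e i‖₊ • (vectorMeasureCoord μ i).totalVariation := by
    refine VectorMeasure.variation_le_of_forall_enorm_le fun A _ => ?_
    rw [← sum_vectorMeasureCoord_smul, Measure.finsetSum_apply]
    refine (enorm_sum_le _ _).trans (Finset.sum_le_sum fun i _ => ?_)
    rw [enorm_smul, mul_comm, Measure.smul_apply, ENNReal.smul_def, smul_eq_mul]
    exact mul_le_mul_right ((vectorMeasureCoord μ i).enorm_le_totalVariation A) _
  exact isFiniteMeasure_of_le _ hle

theorem exists_eq_withDensityᵥ_of_absolutelyContinuous [MeasurableSpace F] [BorelSpace F]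
    (μ : VectorMeasure X F) (ρ : Measure X) [SigmaFinite ρ]
    (hμ : μ.variation ≪ ρ) :
    ∃ f : X → F, Measurable f ∧ Integrable f ρ ∧ μ = ρ.withDensityᵥ f := by
  set e := Module.finBasis ℝ F
  set g := fun i => (vectorMeasureCoord μ i).rnDeriv ρ
  have hgi : ∀ i, Integrable (fun x => g i x • e i) ρ := fun i =>
    (SignedMeasure.integrable_rnDeriv _ _).smul_const _
  have hcoord : ∀ i, ρ.withDensityᵥ (g i) = vectorMeasureCoord μ i := fun i => by
    refine SignedMeasure.withDensityᵥ_rnDeriv_eq _ _ (VectorMeasure.AbsolutelyContinuous.mk ?_)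
    intro A hAm hA
    rw [Measure.toENNRealVectorMeasure_apply_measurable hAm] at hA
    have hμA : μ A = 0 := by
      simpa [hμ hA] using VectorMeasure.enorm_measure_le_variation μ A
    exact (congrArg (e.coord i) hμA).trans (map_zero _)
  have hfi : Integrable (fun x => ∑ i, g i x • e i) ρ :=
    integrable_finsetSum _ fun i _ => hgi i
  refine ⟨fun x => ∑ i, g i x • e i, Finset.univ.measurable_sum fun i _ =>
    (SignedMeasure.measurable_rnDeriv _ _).smul_const _, hfi, ?_⟩
  ext A hA
  rw [withDensityᵥ_apply hfi hA, integral_finsetSum _ fun i _ => (hgi i).integrableOn,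
    ← sum_vectorMeasureCoord_smul]
  refine Finset.sum_congr rfl fun i _ => ?_
  rw [integral_smul_const, ← hcoord i,
    withDensityᵥ_apply (SignedMeasure.integrable_rnDeriv _ _) hA]

theorem ae_norm_eq_one_of_variation_eq {ρ : Measure X} {f : X → F} (hf : Integrable f ρ)
    (h : (ρ.withDensityᵥ f).variation = ρ) : ∀ᵐ x ∂ρ, ‖f x‖ = 1 := by
  have hv : ρ.withDensity (fun x => ‖f x‖ₑ) = ρ.withDensity 1 := by
    rw [← Measure.variation_withDensityᵥ hf, h, withDensity_one]
  filter_upwards [(withDensity_eq_iff hf.1.enorm aemeasurable_const hf.2.ne).1 hv] with x hx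
  simpa [← ofReal_norm] using hx

theorem exists_eq_variation_withDensityᵥ (μ : VectorMeasure X F) [MeasurableSpace F]
    [BorelSpace F] :
    ∃ b : X → F, Measurable b ∧ (∀ x, ‖b x‖ ≤ 1) ∧ (∀ᵐ x ∂μ.variation, ‖b x‖ = 1) ∧
      μ = μ.variation.withDensityᵥ b := by
  obtain ⟨f, hfm, hfi, hμ⟩ := exists_eq_withDensityᵥ_of_absolutelyContinuous μ μ.variation
    .rfl
  have hf1 : ∀ᵐ x ∂μ.variation, ‖f x‖ = 1 :=
    ae_norm_eq_one_of_variation_eq hfi (congrArg _ hμ.symm)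
  have hcut : ∀ᵐ x ∂μ.variation, (if ‖f x‖ = 1 then f x else 0) = f x :=
    hf1.mono fun x hx => if_pos hx
  refine ⟨fun x => if ‖f x‖ = 1 then f x else 0,
    Measurable.ite (measurableSet_eq_fun hfm.norm measurable_const) hfm measurable_const,
    fun x => ?_, ?_, hμ.trans (WithDensityᵥEq.congr_ae hcut).symm⟩
  · dsimp only
    split_ifs with h <;> simp [h]
  · filter_upwards [hf1, hcut] with x hx hxc
    rw [hxc, hx]

end Polar

theorem variation_withDensityᵥ_of_norm_eq_one [CompleteSpace F] {ρ : Measure X}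
    [IsFiniteMeasure ρ] {b : X → F} (hb : AEStronglyMeasurable b ρ) (hb1 : ∀ᵐ x ∂ρ, ‖b x‖ = 1) :
    (ρ.withDensityᵥ b).variation = ρ := by
  rw [Measure.variation_withDensityᵥ (.of_bound hb 1 (hb1.mono fun x hx => hx.le)),
    withDensity_congr_ae (g := 1) (hb1.mono fun x hx => by simp [← ofReal_norm, hx]),
    withDensity_one]

section Integral

variable [CompleteSpace F] {ρ : Measure X} {b : X → F} {φ ψ : X → E}
  (B : E →L[ℝ] F →L[ℝ] G)

theorem integrable_bilin_of_integrable_withDensityᵥ (hb : Integrable b ρ)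
    (hφ : (ρ.withDensityᵥ b).Integrable φ) : Integrable (fun x => B (φ x) (b x)) ρ := by
  rw [VectorMeasure.Integrable, Measure.variation_withDensityᵥ hb] at hφ
  have hbφ : Integrable (fun x => ‖b x‖₊ • φ x) ρ :=
    (integrable_withDensity_iff_integrable_smul₀ hb.1.nnnorm.aemeasurable).1 hφ
  have hunit : AEStronglyMeasurable (fun x => ‖b x‖⁻¹ • b x) ρ :=
    hb.1.norm.aemeasurable.inv.aestronglyMeasurable.smul hb.1
  have hpolar : ∀ x, B (φ x) (b x) = B (‖b x‖₊ • φ x) (‖b x‖⁻¹ • b x) := fun x => by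
    rcases eq_or_ne (b x) 0 with h0 | h0
    · simp [h0]
    · simp [NNReal.smul_def, smul_smul, h0]
  simp only [hpolar]
  refine Integrable.mono' (hbφ.norm.const_mul ‖B‖)
    (B.aestronglyMeasurable_comp₂ hbφ.1 hunit) (ae_of_all _ fun x => ?_)
  refine (B.le_opNorm₂ _ _).trans (mul_le_of_le_one_right (by positivity) ?_)
  rw [norm_smul, norm_inv, norm_norm]
  exact inv_mul_le_one

theorem lintegral_enorm_bilin_le (hb : Integrable b ρ)
    (hφ : AEStronglyMeasurable φ (ρ.withDensityᵥ b).variation) :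
    ∫⁻ x, ‖B (φ x) (b x)‖ₑ ∂ρ ≤ ‖B‖ₑ * ∫⁻ x, ‖φ x‖ₑ ∂(ρ.withDensityᵥ b).variation := by
  rw [Measure.variation_withDensityᵥ hb] at hφ ⊢
  rw [lintegral_withDensity_eq_lintegral_mul₀' hb.1.enorm hφ.enorm,
    ← lintegral_const_mul' _ _ enorm_ne_top]
  refine lintegral_mono fun x => ?_
  simpa [mul_assoc, mul_comm ‖b x‖ₑ] using B.le_opENorm₂ (φ x) (b x)

theorem ae_bilin_eq_of_ae_variation_withDensityᵥ_eq (hb : Integrable b ρ)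
    (hφψ : φ =ᵐ[(ρ.withDensityᵥ b).variation] ψ) : ∀ᵐ x ∂ρ, B (φ x) (b x) = B (ψ x) (b x) := by
  have h : ∀ᵐ x ∂ρ.withDensity fun x => ‖b x‖ₑ, φ x = ψ x :=
    Measure.variation_withDensityᵥ hb ▸ hφψ
  filter_upwards [(ae_withDensity_iff' hb.1.enorm).1 h] with x hx
  rcases eq_or_ne (b x) 0 with h0 | h0
  · rw [h0, map_zero, map_zero]
  · rw [hx (enorm_ne_zero.2 h0)]

theorem continuous_integral_bilin_withDensityᵥ (hb : Integrable b ρ) :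
    Continuous fun f : X →₁[(ρ.withDensityᵥ b).variation] E => ∫ x, B (f x) (b x) ∂ρ := by
  have hint (f : X →₁[(ρ.withDensityᵥ b).variation] E) : Integrable (fun x => B (f x) (b x)) ρ :=
    integrable_bilin_of_integrable_withDensityᵥ B hb (L1.integrable_coeFn f)
  refine continuous_iff_continuousAt.2 fun g =>
    tendsto_integral_of_L1 _ (hint g).1 (.of_forall hint) ?_
  have hdist : Filter.Tendsto (fun f : X →₁[(ρ.withDensityᵥ b).variation] E =>
      ‖B‖ₑ * ∫⁻ x, ‖f x - g x‖ₑ ∂(ρ.withDensityᵥ b).variation) (nhds g) (nhds 0) := by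
    have h := tendsto_iff_edist_tendsto_0.1 (Filter.tendsto_id (x := nhds g))
    simpa [Lp.edist_def, eLpNorm_one_eq_lintegral_enorm] using
      ENNReal.Tendsto.const_mul h (Or.inr (enorm_ne_top (x := B)))
  refine tendsto_of_tendsto_of_tendsto_of_le_of_le tendsto_const_nhds hdist
    (fun _ => zero_le) fun f => ?_
  simpa using lintegral_enorm_bilin_le B hb
    ((Lp.aestronglyMeasurable f).sub (Lp.aestronglyMeasurable g))

theorem integral_withDensityᵥ [CompleteSpace G] (hb : Integrable b ρ)
    (hφ : (ρ.withDensityᵥ b).Integrable φ) :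
    VectorMeasure.integral (ρ.withDensityᵥ b) φ B = ∫ x, B (φ x) (b x) ∂ρ := by
  have hint : ∀ {f : X → E}, (ρ.withDensityᵥ b).Integrable f →
      Integrable (fun x => B (f x) (b x)) ρ := integrable_bilin_of_integrable_withDensityᵥ B hb
  have : IsFiniteMeasure (ρ.withDensityᵥ b).variation := by
    rw [Measure.variation_withDensityᵥ hb]; exact isFiniteMeasure_withDensity hb.2.ne
  refine Integrable.induction (fun f : X → E => VectorMeasure.integral (ρ.withDensityᵥ b) f B =
    ∫ x, B (f x) (b x) ∂ρ) ?_ ?_ ?_ ?_ hφ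
  · intro c s hs _
    have hind : ∀ x, B (s.indicator (fun _ => c) x) (b x) = s.indicator (fun x => B c (b x)) x :=
      fun x => by by_cases hx : x ∈ s <;> simp [hx]
    rw [VectorMeasure.integral_indicator hs, VectorMeasure.integral_const,
      VectorMeasure.restrict_apply _ hs MeasurableSet.univ, Set.univ_inter,
      withDensityᵥ_apply hb hs, ← (B c).integral_comp_comm hb.integrableOn]
    simp only [hind, integral_indicator hs]
  · intro f g _ hf hg hfI hgI
    rw [VectorMeasure.integral_add hf hg, hfI, hgI, ← integral_add (hint hf) (hint hg)]
    simp only [Pi.add_apply, map_add, add_apply]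
  · exact isClosed_eq VectorMeasure.continuous_integral
      (continuous_integral_bilin_withDensityᵥ B hb)
  · intro f g hfg _ hfI
    rw [← VectorMeasure.integral_congr_ae hfg, hfI,
      integral_congr_ae (ae_bilin_eq_of_ae_variation_withDensityᵥ_eq B hb hfg)]

end Integral

end VectorMeasures

section Kernels

/-- A positive bounded kernel `K ≤ M` whose logarithm is Lipschitz, in the weak form that the
increments of `K` are controlled by its own values. This is what makes the quotient
`(K * (b ρ)) / (K * ρ)` Lipschitz no matter how irregular `b` and `ρ` are. -/
structure IsLogLipschitzKernel {E : Type*} [NormedAddCommGroup E] (K : E → ℝ) (C : ℝ≥0)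
    (M : ℝ) : Prop where
  pos : ∀ x, 0 < K x
  le : ∀ x, K x ≤ M
  abs_sub_le : ∀ x y, |K x - K y| ≤ C * ‖x - y‖ * (K x + K y)

theorem abs_exp_neg_sub_exp_neg_le (s t : ℝ) :
    |Real.exp (-s) - Real.exp (-t)| ≤ |s - t| * (Real.exp (-s) + Real.exp (-t)) := by
  wlog hst : s ≤ t generalizing s t
  · simpa only [abs_sub_comm, add_comm] using this t s (le_of_not_ge hst)
  have hexp : Real.exp (-t) = Real.exp (-s) * Real.exp (s - t) := by
    rw [← Real.exp_add]; ring_nf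
  have hmono : Real.exp (-t) ≤ Real.exp (-s) := Real.exp_le_exp.2 (neg_le_neg hst)
  rw [abs_of_nonneg (sub_nonneg.2 hmono), abs_sub_comm, abs_of_nonneg (sub_nonneg.2 hst)]
  calc Real.exp (-s) - Real.exp (-t) = Real.exp (-s) * (1 - Real.exp (s - t)) := by
        rw [hexp]; ring
    _ ≤ Real.exp (-s) * (t - s) :=
        mul_le_mul_of_nonneg_left (by linarith [Real.add_one_le_exp (s - t)]) (Real.exp_pos _).le
    _ ≤ (t - s) * (Real.exp (-s) + Real.exp (-t)) := by
        nlinarith [mul_nonneg (sub_nonneg.2 hst) (Real.exp_pos (-t)).le]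

variable {E : Type*} [NormedAddCommGroup E]

protected theorem IsLogLipschitzKernel.continuous {K : E → ℝ} {C : ℝ≥0} {M : ℝ}
    (hK : IsLogLipschitzKernel K C M) : Continuous K := by
  have hM : 0 ≤ M := (hK.pos 0).le.trans (hK.le 0)
  refine (LipschitzWith.of_dist_le_mul (K := C * (M + M).toNNReal) fun x y => ?_).continuous
  rw [Real.dist_eq, dist_eq_norm, NNReal.coe_mul, mul_right_comm,
    Real.coe_toNNReal _ (by positivity)]
  refine (hK.abs_sub_le x y).trans (mul_le_mul_of_nonneg_left ?_ (by positivity))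
  exact add_le_add (hK.le x) (hK.le y)

theorem isLogLipschitzKernel_exp_neg_norm {c : ℝ} (hc : 0 < c) (r : ℝ≥0) :
    IsLogLipschitzKernel (fun x : E => c * Real.exp (-(r * ‖x‖))) r c where
  pos x := mul_pos hc (Real.exp_pos _)
  le x := mul_le_of_le_one_right hc.le (Real.exp_le_one_iff.2 (neg_nonpos.2 (by positivity)))
  abs_sub_le x y := by
    have hnorm : |r * ‖x‖ - r * ‖y‖| ≤ r * ‖x - y‖ := by
      rw [← mul_sub, abs_mul, NNReal.abs_eq]
      exact mul_le_mul_of_nonneg_left (abs_norm_sub_norm_le x y) r.2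
    rw [← mul_sub, abs_mul, abs_of_pos hc, ← mul_add, mul_left_comm]
    refine mul_le_mul_of_nonneg_left ((abs_exp_neg_sub_exp_neg_le _ _).trans ?_) hc.le
    exact mul_le_mul_of_nonneg_right hnorm (by positivity)

variable [NormedSpace ℝ E] [FiniteDimensional ℝ E] [MeasurableSpace E] [BorelSpace E]
  (vol : Measure E) [vol.IsAddHaarMeasure]

theorem integrable_exp_neg_norm : Integrable (fun x : E => Real.exp (-‖x‖)) vol := by
  set p := Module.finrank ℝ E + 1 with hp
  have hint : Integrable (fun x : E => (1 + ‖x‖) ^ (-(p : ℝ))) vol :=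
    integrable_one_add_norm (by rw [hp]; push_cast; linarith)
  refine (hint.const_mul (p.factorial * Real.exp 1)).mono'
    (by fun_prop : Continuous fun x : E => Real.exp (-‖x‖)).aestronglyMeasurable
    (ae_of_all _ fun x => ?_)
  have hpow : (1 + ‖x‖) ^ p / p.factorial ≤ Real.exp (1 + ‖x‖) :=
    Real.pow_div_factorial_le_exp _ (by positivity) p
  rw [Real.norm_of_nonneg (Real.exp_pos _).le, Real.rpow_neg (by positivity), Real.rpow_natCast,
    Real.exp_neg, ← div_eq_mul_inv, inv_le_comm₀ (Real.exp_pos _) (by positivity), inv_div,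
    div_le_iff₀ (by positivity)]
  rw [Real.exp_add, div_le_iff₀ (by positivity)] at hpow
  linarith

theorem map_smul_withDensity {ε : ℝ} (hε : ε ≠ 0) {f : E → ℝ≥0∞} (hf : Measurable f) :
    (vol.withDensity f).map (fun x => ε • x) =
      vol.withDensity fun x => ENNReal.ofReal |(ε ^ Module.finrank ℝ E)⁻¹| * f (ε⁻¹ • x) := by
  refine Measure.ext_of_lintegral _ fun g hg => ?_
  have hmeas : Measurable fun x : E => ε • x := measurable_const_smul ε
  have hcancel : ∀ x : E, ε⁻¹ • ε • x = x := inv_smul_smul₀ hε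
  rw [lintegral_map hg hmeas, lintegral_withDensity_eq_lintegral_mul _ hf (by fun_prop),
    lintegral_withDensity_eq_lintegral_mul _ (by fun_prop) hg]
  calc ∫⁻ x, (f * fun y => g (ε • y)) x ∂vol
      = ∫⁻ x, f (ε⁻¹ • x) * g x ∂vol.map (fun x => ε • x) := by
        rw [lintegral_map (by fun_prop) hmeas]
        simp only [hcancel, Pi.mul_apply]
    _ = _ := by
        rw [Measure.map_addHaar_smul vol hε, lintegral_smul_measure, smul_eq_mul,
          ← lintegral_const_mul _ (by fun_prop)]
        simp only [Pi.mul_apply, mul_assoc]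

theorem exists_isLogLipschitzKernel :
    ∃ κ : Measure E, IsProbabilityMeasure κ ∧ ∀ ε : ℝ, 0 < ε → ∃ (K : E → ℝ) (C : ℝ≥0) (M : ℝ),
      IsLogLipschitzKernel K C M ∧
        κ.map (fun x => ε • x) = vol.withDensity fun x => ENNReal.ofReal (K x) := by
  have hint := integrable_exp_neg_norm vol
  have hpos : 0 < ∫ x, Real.exp (-‖x‖) ∂vol := integral_exp_pos hint
  set c := (∫ x, Real.exp (-‖x‖) ∂vol)⁻¹ with hc
  have hc0 : 0 < c := inv_pos.2 hpos
  refine ⟨vol.withDensity fun x => ENNReal.ofReal (c * Real.exp (-‖x‖)), ⟨?_⟩, fun ε hε => ?_⟩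
  · rw [withDensity_apply _ MeasurableSet.univ, Measure.restrict_univ,
      ← ofReal_integral_eq_lintegral_ofReal (hint.const_mul c)
        (ae_of_all _ fun x => mul_nonneg hc0.le (Real.exp_pos _).le), integral_const_mul, hc,
      inv_mul_cancel₀ hpos.ne', ENNReal.ofReal_one]
  · have hε0 : 0 < |(ε ^ Module.finrank ℝ E)⁻¹| := by positivity
    refine ⟨_, _, _, isLogLipschitzKernel_exp_neg_norm (mul_pos hε0 hc0) ε⁻¹.toNNReal, ?_⟩
    rw [map_smul_withDensity vol hε.ne' (by fun_prop)]
    congr 1 with x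
    have hε' : 0 ≤ ε⁻¹ := (inv_pos.2 hε).le
    rw [← ENNReal.ofReal_mul (abs_nonneg _), ← mul_assoc, norm_smul, Real.norm_of_nonneg hε',
      Real.coe_toNNReal _ hε']

end Kernels

section Mollification

variable {E F : Type*} [NormedAddCommGroup E] [MeasurableSpace E] [NormedAddCommGroup F]
  [NormedSpace ℝ F]

/-- The density `K * (b ρ)` of the mollification of the vector measure `b ρ`. -/
noncomputable def mollify (K : E → ℝ) (ρ : Measure E) (b : E → F) (x : E) : F :=
  ∫ z, K (x - z) • b z ∂ρ

/-- The density `K * ρ` of the mollification of `ρ`. -/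
noncomputable def mollifiedDensity (K : E → ℝ) (ρ : Measure E) (x : E) : ℝ :=
  ∫ z, K (x - z) ∂ρ

/-- The velocity field `(K * (b ρ)) / (K * ρ)` of the mollification of `b ρ`. -/
noncomputable def mollifiedField (K : E → ℝ) (ρ : Measure E) (b : E → F) (x : E) : F :=
  (mollifiedDensity K ρ x)⁻¹ • mollify K ρ b x

theorem mollify_one (K : E → ℝ) (ρ : Measure E) :
    mollify K ρ (fun _ => (1 : ℝ)) = mollifiedDensity K ρ := by
  ext x
  simp only [mollify, mollifiedDensity, smul_eq_mul, mul_one]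

namespace IsLogLipschitzKernel

variable [BorelSpace E] {K : E → ℝ} {C : ℝ≥0} {M : ℝ} {ρ : Measure E} {b : E → F}

variable [IsFiniteMeasure ρ]

theorem integrable_sub (hK : IsLogLipschitzKernel K C M) (x : E) :
    Integrable (fun z => K (x - z)) ρ :=
  .of_bound (hK.continuous.comp (by fun_prop)).aestronglyMeasurable M
    (ae_of_all _ fun z => by rw [Real.norm_of_nonneg (hK.pos _).le]; exact hK.le _)

theorem integrable_sub_smul (hK : IsLogLipschitzKernel K C M) (hb : AEStronglyMeasurable b ρ)
    (hb1 : ∀ᵐ x ∂ρ, ‖b x‖ ≤ 1) (x : E) : Integrable (fun z => K (x - z) • b z) ρ :=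
  (hK.integrable_sub x).smul_of_top_left (memLp_top_of_bound hb 1 hb1)

theorem mollifiedDensity_pos [NeZero ρ] (hK : IsLogLipschitzKernel K C M) (x : E) :
    0 < mollifiedDensity K ρ x := by
  refine (integral_pos_iff_support_of_nonneg (fun z => (hK.pos _).le) (hK.integrable_sub x)).2 ?_
  rw [Function.support_eq_univ fun z => (hK.pos (x - z)).ne']
  exact Measure.measure_univ_pos.2 (NeZero.ne ρ)

theorem mollifiedDensity_le (hK : IsLogLipschitzKernel K C M) (x : E) :
    mollifiedDensity K ρ x ≤ M * ρ.real Set.univ := by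
  refine (integral_mono (hK.integrable_sub x) (integrable_const M) fun z => hK.le _).trans_eq ?_
  rw [integral_const, smul_eq_mul, mul_comm]

theorem norm_mollify_le (hK : IsLogLipschitzKernel K C M) (hb1 : ∀ᵐ x ∂ρ, ‖b x‖ ≤ 1) (x : E) :
    ‖mollify K ρ b x‖ ≤ mollifiedDensity K ρ x := by
  refine norm_integral_le_of_norm_le (hK.integrable_sub x) (hb1.mono fun z hz => ?_)
  rw [norm_smul, Real.norm_of_nonneg (hK.pos _).le]
  exact mul_le_of_le_one_right (hK.pos _).le hz

theorem norm_mollify_sub_le (hK : IsLogLipschitzKernel K C M) (hb : AEStronglyMeasurable b ρ)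
    (hb1 : ∀ᵐ x ∂ρ, ‖b x‖ ≤ 1) (x y : E) :
    ‖mollify K ρ b x - mollify K ρ b y‖ ≤
      C * ‖x - y‖ * (mollifiedDensity K ρ x + mollifiedDensity K ρ y) := by
  have hx := hK.integrable_sub (ρ := ρ) x
  have hy := hK.integrable_sub (ρ := ρ) y
  rw [mollify, mollify, mollifiedDensity, mollifiedDensity, ← integral_add hx hy,
    ← integral_sub (hK.integrable_sub_smul hb hb1 x) (hK.integrable_sub_smul hb hb1 y),
    ← integral_const_mul]
  refine norm_integral_le_of_norm_le ((hx.add hy).const_mul _) (hb1.mono fun z hz => ?_)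
  rw [← sub_smul, norm_smul]
  refine (mul_le_of_le_one_right (norm_nonneg _) hz).trans ?_
  simpa using hK.abs_sub_le (x - z) (y - z)

theorem abs_mollifiedDensity_sub_le (hK : IsLogLipschitzKernel K C M) (x y : E) :
    |mollifiedDensity K ρ x - mollifiedDensity K ρ y| ≤
      C * ‖x - y‖ * (mollifiedDensity K ρ x + mollifiedDensity K ρ y) := by
  simpa only [mollify_one, Real.norm_eq_abs] using hK.norm_mollify_sub_le (b := fun _ => (1 : ℝ))
    aestronglyMeasurable_const (ae_of_all ρ fun _ => norm_one.le) x y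

theorem exists_lipschitzWith_mollify (hK : IsLogLipschitzKernel K C M)
    (hb : AEStronglyMeasurable b ρ) (hb1 : ∀ᵐ x ∂ρ, ‖b x‖ ≤ 1) :
    ∃ L : ℝ≥0, LipschitzWith L (mollify K ρ b) := by
  have hM : 0 ≤ M := (hK.pos 0).le.trans (hK.le 0)
  refine ⟨C * (M * ρ.real Set.univ + M * ρ.real Set.univ).toNNReal,
    LipschitzWith.of_dist_le_mul fun x y => ?_⟩
  rw [dist_eq_norm, dist_eq_norm, NNReal.coe_mul, mul_right_comm,
    Real.coe_toNNReal _ (by positivity)]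
  refine (hK.norm_mollify_sub_le hb hb1 x y).trans (mul_le_mul_of_nonneg_left ?_ (by positivity))
  exact add_le_add (hK.mollifiedDensity_le x) (hK.mollifiedDensity_le y)

theorem continuous_mollifiedDensity (hK : IsLogLipschitzKernel K C M) :
    Continuous (mollifiedDensity K ρ) := by
  obtain ⟨L, hL⟩ := hK.exists_lipschitzWith_mollify (b := fun _ => (1 : ℝ))
    aestronglyMeasurable_const (ae_of_all ρ fun _ => norm_one.le)
  exact mollify_one K ρ ▸ hL.continuous

variable [NeZero ρ]

theorem mollifiedDensity_smul_mollifiedField (hK : IsLogLipschitzKernel K C M) (b : E → F)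
    (x : E) : mollifiedDensity K ρ x • mollifiedField K ρ b x = mollify K ρ b x :=
  smul_inv_smul₀ (hK.mollifiedDensity_pos (ρ := ρ) x).ne' _

theorem mollifiedDensity_smul_sub [CompleteSpace F] (hK : IsLogLipschitzKernel K C M)
    (hb : AEStronglyMeasurable b ρ) (hb1 : ∀ᵐ x ∂ρ, ‖b x‖ ≤ 1) (x : E) (v : F) :
    mollifiedDensity K ρ x • (mollifiedField K ρ b x - v) = ∫ z, K (x - z) • (b z - v) ∂ρ := by
  simp only [smul_sub]
  rw [hK.mollifiedDensity_smul_mollifiedField,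
    integral_sub (hK.integrable_sub_smul hb hb1 x) ((hK.integrable_sub x).smul_const v),
    integral_smul_const, mollify, mollifiedDensity]

theorem norm_mollifiedField_le (hK : IsLogLipschitzKernel K C M) (hb1 : ∀ᵐ x ∂ρ, ‖b x‖ ≤ 1)
    (x : E) : ‖mollifiedField K ρ b x‖ ≤ 1 := by
  have hr : 0 < mollifiedDensity K ρ x := hK.mollifiedDensity_pos x
  rw [mollifiedField, norm_smul, norm_inv, Real.norm_of_nonneg hr.le, inv_mul_le_iff₀ hr, mul_one]
  exact hK.norm_mollify_le hb1 x

theorem lipschitzWith_mollifiedField (hK : IsLogLipschitzKernel K C M)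
    (hb : AEStronglyMeasurable b ρ) (hb1 : ∀ᵐ x ∂ρ, ‖b x‖ ≤ 1) :
    LipschitzWith (4 * C) (mollifiedField K ρ b) := by
  refine LipschitzWith.of_dist_le_mul fun x y => ?_
  wlog hxy : mollifiedDensity K ρ y ≤ mollifiedDensity K ρ x generalizing x y
  · rw [dist_comm, dist_comm x]
    exact this y x (le_of_not_ge hxy)
  rw [dist_eq_norm, dist_eq_norm]
  have hV := hK.norm_mollify_sub_le hb hb1 x y
  have hr := hK.abs_mollifiedDensity_sub_le (ρ := ρ) x y
  have hVy : ‖mollifiedField K ρ b y‖ ≤ 1 := hK.norm_mollifiedField_le hb1 y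
  have hrx : 0 < mollifiedDensity K ρ x := hK.mollifiedDensity_pos x
  rw [← hK.mollifiedDensity_smul_mollifiedField, ← hK.mollifiedDensity_smul_mollifiedField] at hV
  set V := mollifiedField K ρ b
  set r := mollifiedDensity K ρ
  refine le_of_mul_le_mul_left ?_ hrx
  calc r x * ‖V x - V y‖ = ‖(r x • V x - r y • V y) + (r y - r x) • V y‖ := by
        rw [← Real.norm_of_nonneg hrx.le, ← norm_smul, Real.norm_of_nonneg hrx.le]
        congr 1
        module
    _ ≤ ‖r x • V x - r y • V y‖ + |r x - r y| := by
        refine (norm_add_le _ _).trans (add_le_add le_rfl ?_)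
        rw [norm_smul, norm_sub_rev]
        exact mul_le_of_le_one_right (norm_nonneg _) hVy
    _ ≤ C * ‖x - y‖ * (r x + r x) + C * ‖x - y‖ * (r x + r x) := by
        refine (add_le_add hV hr).trans ?_
        gcongr
    _ = r x * ((4 * C : ℝ≥0) * ‖x - y‖) := by push_cast; ring

end IsLogLipschitzKernel

section Convolution

variable [BorelSpace E] [SecondCountableTopology E] (ρ vol : Measure E) [SFinite ρ] [SFinite vol]
  [vol.IsAddLeftInvariant]

theorem lintegral_lintegral_sub_mul {k : E → ℝ≥0∞} (hk : Measurable k) {f : E → E → ℝ≥0∞}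
    (hf : Measurable (Function.uncurry f)) :
    ∫⁻ x, ∫⁻ z, k (x - z) * f z x ∂ρ ∂vol =
      ∫⁻ z, ∫⁻ y, f z (z + y) ∂(vol.withDensity k) ∂ρ := by
  rw [lintegral_lintegral_swap (Measurable.aemeasurable (by fun_prop))]
  refine lintegral_congr fun z => ?_
  rw [lintegral_withDensity_eq_lintegral_mul _ hk (by fun_prop),
    ← lintegral_add_left_eq_self (fun x => k (x - z) * f z x) z]
  simp only [add_sub_cancel_left, Pi.mul_apply]

theorem conv_withDensity {k : E → ℝ≥0∞} (hk : Measurable k) :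
    ρ.conv (vol.withDensity k) = vol.withDensity fun x => ∫⁻ z, k (x - z) ∂ρ := by
  refine Measure.ext_of_lintegral _ fun g hg => ?_
  rw [Measure.lintegral_conv hg, lintegral_withDensity_eq_lintegral_mul _ (by fun_prop) hg,
    ← lintegral_lintegral_sub_mul ρ vol hk (f := fun _ => g) (by fun_prop)]
  exact lintegral_congr fun x => lintegral_mul_const _ (by fun_prop)

variable {K : E → ℝ} {C : ℝ≥0} {M : ℝ} [IsFiniteMeasure ρ]

theorem IsLogLipschitzKernel.conv_withDensity_ofReal (hK : IsLogLipschitzKernel K C M) :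
    ρ.conv (vol.withDensity fun x => ENNReal.ofReal (K x)) =
      vol.withDensity fun x => ENNReal.ofReal (mollifiedDensity K ρ x) := by
  have hKm : Measurable K := hK.continuous.measurable
  rw [conv_withDensity ρ vol (by fun_prop)]
  congr 1 with x
  exact (ofReal_integral_eq_lintegral_ofReal (hK.integrable_sub x)
    (ae_of_all _ fun z => (hK.pos _).le)).symm

theorem IsLogLipschitzKernel.lintegral_enorm_mollifiedField_sub_le [CompleteSpace F] [NeZero ρ]
    {b c : E → F} (hK : IsLogLipschitzKernel K C M) (hb : StronglyMeasurable b)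
    (hb1 : ∀ᵐ x ∂ρ, ‖b x‖ ≤ 1) (hc : StronglyMeasurable c) :
    ∫⁻ x, ‖mollifiedField K ρ b x - c x‖ₑ
        ∂(ρ.conv (vol.withDensity fun x => ENNReal.ofReal (K x))) ≤
      ∫⁻ z, ∫⁻ y, ‖b z - c (z + y)‖ₑ ∂(vol.withDensity fun x => ENNReal.ofReal (K x)) ∂ρ := by
  have hKm : Measurable K := hK.continuous.measurable
  have hrm : Measurable (mollifiedDensity K ρ) := hK.continuous_mollifiedDensity.measurable
  have hdiff : Measurable fun x => ‖mollifiedField K ρ b x - c x‖ₑ :=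
    ((hK.lipschitzWith_mollifiedField hb.aestronglyMeasurable
      hb1).continuous.stronglyMeasurable.sub hc).enorm
  have hdist : Measurable fun p : E × E => ‖b p.1 - c p.2‖ₑ :=
    ((hb.comp_measurable measurable_fst).sub (hc.comp_measurable measurable_snd)).enorm
  rw [hK.conv_withDensity_ofReal ρ vol, ← lintegral_lintegral_sub_mul ρ vol (by fun_prop)
    (f := fun z x => ‖b z - c x‖ₑ) hdist,
    lintegral_withDensity_eq_lintegral_mul _ (by fun_prop) hdiff]
  refine lintegral_mono fun x => ?_
  calc ENNReal.ofReal (mollifiedDensity K ρ x) * ‖mollifiedField K ρ b x - c x‖ₑ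
      = ‖∫ z, K (x - z) • (b z - c x) ∂ρ‖ₑ := by
        rw [← Real.enorm_eq_ofReal (hK.mollifiedDensity_pos x).le, ← enorm_smul,
          hK.mollifiedDensity_smul_sub hb.aestronglyMeasurable hb1]
    _ ≤ ∫⁻ z, ‖K (x - z) • (b z - c x)‖ₑ ∂ρ := enorm_integral_le_lintegral_enorm _
    _ = ∫⁻ z, ENNReal.ofReal (K (x - z)) * ‖b z - c x‖ₑ ∂ρ := by
        simp only [enorm_smul, Real.enorm_eq_ofReal (hK.pos _).le]

end Convolution

end Mollification

section DivergenceFree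

variable {E : Type*} [NormedAddCommGroup E] [NormedSpace ℝ E]

theorem hasCompactSupport_lineDeriv {v : E → ℝ} (hv : HasCompactSupport v) (y : E) :
    HasCompactSupport fun x => lineDeriv ℝ v x y := by
  refine HasCompactSupport.intro' hv (isClosed_tsupport v) fun x hx => ?_
  rw [(notMem_tsupport_iff_eventuallyEq.1 hx).lineDeriv_eq, lineDeriv]
  exact deriv_const _ _

/-- The divergence of a vector field, as the sum of the directional derivatives of its coordinates
in the basis `Module.finBasis ℝ E`. -/
noncomputable def divergence [FiniteDimensional ℝ E] (m : E → E) (x : E) : ℝ :=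
  ∑ i, lineDeriv ℝ (fun y => (Module.finBasis ℝ E).coord i (m y)) x (Module.finBasis ℝ E i)

theorem exists_lipschitzWith_coord [FiniteDimensional ℝ E] {m : E → E} {L : ℝ≥0}
    (hm : LipschitzWith L m) (i : Fin (Module.finrank ℝ E)) :
    ∃ C : ℝ≥0, LipschitzWith C fun x => (Module.finBasis ℝ E).coord i (m x) :=
  ⟨_, (LinearMap.toContinuousLinearMap ((Module.finBasis ℝ E).coord i)).lipschitz.comp hm⟩

variable [MeasurableSpace E]

/-- The vector measure `b ρ` has distributional divergence zero. -/
def IsDivFree (ρ : Measure E) (b : E → E) : Prop :=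
  ∀ ψ : E → ℝ, ContDiff ℝ ∞ ψ → HasCompactSupport ψ → ∫ x, fderiv ℝ ψ x (b x) ∂ρ = 0

/-- The vector measure `b ρ` has divergence zero when tested with Lipschitz functions. This is meant
for `ρ` absolutely continuous with respect to Lebesgue measure: the junk values of `fderiv` at
points where the test function is not differentiable are then irrelevant, by Rademacher's
theorem. -/
def IsLipschitzDivFree (ρ : Measure E) (b : E → E) : Prop :=
  ∀ (u : E → ℝ) (D : ℝ≥0), LipschitzWith D u → HasCompactSupport u →
    ∫ x, fderiv ℝ u x (b x) ∂ρ = 0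

theorem integrable_clm_apply_snd {X Y F G : Type*} [MeasurableSpace X] [MeasurableSpace Y]
    [NormedAddCommGroup F] [NormedSpace ℝ F] [NormedAddCommGroup G] [NormedSpace ℝ G]
    {μ : Measure X} {ρ : Measure Y} [SFinite μ] [IsFiniteMeasure ρ] {b : Y → F}
    (hb : AEStronglyMeasurable b ρ) (hb1 : ∀ᵐ y ∂ρ, ‖b y‖ ≤ 1) {A : X × Y → F →L[ℝ] G}
    (hA : AEStronglyMeasurable A (μ.prod ρ)) {h : X → ℝ} (hh : Integrable h μ)
    (hAh : ∀ p, ‖A p‖ ≤ h p.1) : Integrable (fun p => A p (b p.2)) (μ.prod ρ) := by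
  refine (hh.comp_fst ρ).mono' ?_ ?_
  · exact isBoundedBilinearMap_apply.continuous.comp_aestronglyMeasurable (hA.prodMk hb.comp_snd)
  · filter_upwards [Measure.quasiMeasurePreserving_snd.ae hb1] with p hp
    exact ((A p).le_of_opNorm_le_of_le (hAh p) hp).trans_eq (mul_one _)

section LipschitzTests

theorem integrable_mul_lineDeriv [BorelSpace E] {f v : E → ℝ} {C : ℝ≥0} {vol : Measure E}
    (hf : LipschitzWith C f) (hv : Integrable v vol) (y : E) :
    Integrable (fun x => v x * lineDeriv ℝ f x y) vol :=
  hv.mul_bdd (c := C * ‖y‖) (aestronglyMeasurable_lineDeriv hf.continuous vol)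
    (ae_of_all _ fun _ => norm_lineDeriv_le_of_lipschitz ℝ hf)

variable [FiniteDimensional ℝ E] [BorelSpace E] {vol : Measure E} [vol.IsAddHaarMeasure]

section

variable {f v : E → ℝ} {C D : ℝ≥0}

theorem integral_lineDeriv_mul_eq_neg (hf : LipschitzWith C f) (hv : LipschitzWith D v)
    (hv' : HasCompactSupport v) (y : E) :
    ∫ x, lineDeriv ℝ v x y * f x ∂vol = -∫ x, v x * lineDeriv ℝ f x y ∂vol := by
  simp only [mul_comm (v _), hf.integral_lineDeriv_mul_eq hv hv' y, lineDeriv_neg, neg_mul,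
    integral_neg, neg_neg]

theorem integrable_lineDeriv_mul (hf : Continuous f) (hv : LipschitzWith D v)
    (hv' : HasCompactSupport v) (y : E) :
    Integrable (fun x => lineDeriv ℝ v x y * f x) vol := by
  have hsupp := hasCompactSupport_lineDeriv hv' y
  refine (integrableOn_iff_integrable_of_support_subset fun x hx => ?_).1
    (((hv.locallyIntegrable_lineDeriv y).integrableOn_isCompact hsupp).mul_continuousOn
      hf.continuousOn hsupp)
  exact subset_tsupport _ (left_ne_zero_of_mul hx)

end

variable {m : E → E} {L D : ℝ≥0}

theorem locallyIntegrable_divergence (hm : LipschitzWith L m) :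
    LocallyIntegrable (divergence m) vol :=
  locallyIntegrable_finsetSum _ fun i _ =>
    (exists_lipschitzWith_coord hm i).choose_spec.locallyIntegrable_lineDeriv _

theorem integral_fderiv_apply_eq_neg_integral_mul_divergence (hm : LipschitzWith L m) {v : E → ℝ}
    (hv : LipschitzWith D v) (hv' : HasCompactSupport v) :
    ∫ x, fderiv ℝ v x (m x) ∂vol = -∫ x, v x * divergence m x ∂vol := by
  choose C hC using exists_lipschitzWith_coord hm
  have hvi : Integrable v vol := hv.continuous.integrable_of_hasCompactSupport hv'
  set e := Module.finBasis ℝ E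
  have hcoord : ∀ᵐ x ∂vol, fderiv ℝ v x (m x) = ∑ i, lineDeriv ℝ v x (e i) * e.coord i (m x) := by
    filter_upwards [hv.ae_differentiableAt] with x hx
    conv_lhs => rw [← e.sum_repr (m x), map_sum]
    simp only [map_smul, hx.lineDeriv_eq_fderiv, smul_eq_mul, mul_comm, Module.Basis.coord_apply]
  calc ∫ x, fderiv ℝ v x (m x) ∂vol
      = ∑ i, ∫ x, lineDeriv ℝ v x (e i) * e.coord i (m x) ∂vol := by
        rw [integral_congr_ae hcoord, integral_finsetSum _ fun i _ =>
          integrable_lineDeriv_mul (hC i).continuous hv hv' (e i)]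
    _ = -∑ i, ∫ x, v x * lineDeriv ℝ (fun y => e.coord i (m y)) x (e i) ∂vol := by
        rw [← Finset.sum_neg_distrib]
        exact Finset.sum_congr rfl fun i _ => integral_lineDeriv_mul_eq_neg (hC i) hv hv' (e i)
    _ = -∫ x, v x * divergence m x ∂vol := by
        rw [← integral_finsetSum _ fun i _ => integrable_mul_lineDeriv (hC i) hvi (e i)]
        simp only [divergence, Finset.mul_sum, e]

theorem ae_divergence_eq_zero (hm : LipschitzWith L m) (hdiv : IsDivFree vol m) :
    ∀ᵐ x ∂vol, divergence m x = 0 := by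
  refine ae_eq_zero_of_integral_contDiff_smul_eq_zero (locallyIntegrable_divergence hm)
    fun g hg hg' => ?_
  obtain ⟨D, hD⟩ := hg.lipschitzWith_of_hasCompactSupport hg' (by simp)
  simpa only [smul_eq_mul, hdiv g hg hg', zero_eq_neg] using
    integral_fderiv_apply_eq_neg_integral_mul_divergence (vol := vol) hm hD hg'

theorem isLipschitzDivFree_of_lipschitzWith (hm : LipschitzWith L m) (hdiv : IsDivFree vol m) :
    IsLipschitzDivFree vol m := fun u D hu hu' => by
  rw [integral_fderiv_apply_eq_neg_integral_mul_divergence hm hu hu', neg_eq_zero]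
  refine integral_eq_zero_of_ae ((ae_divergence_eq_zero hm hdiv).mono fun x hx => ?_)
  simp only [hx, mul_zero, Pi.zero_apply]

end LipschitzTests

section Mollification

variable [FiniteDimensional ℝ E] [BorelSpace E] {K : E → ℝ} {C : ℝ≥0} {M : ℝ} {ρ : Measure E}
  [IsFiniteMeasure ρ] {b : E → E} {vol : Measure E} [vol.IsAddHaarMeasure]

theorem IsLogLipschitzKernel.isDivFree_mollify (hK : IsLogLipschitzKernel K C M)
    (hKi : Integrable K vol) (hb : AEStronglyMeasurable b ρ) (hb1 : ∀ᵐ x ∂ρ, ‖b x‖ ≤ 1)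
    (hdiv : IsDivFree ρ b) : IsDivFree vol (mollify K ρ b) := fun ψ hψ hψ' => by
  have hKc : Continuous K := hK.continuous
  have hdc : Continuous (fderiv ℝ ψ) := hψ.continuous_fderiv (by simp)
  have hds : HasCompactSupport (fderiv ℝ ψ) := hψ'.fderiv ℝ
  obtain ⟨A, hA⟩ := hdc.bounded_above_of_compact_support hds
  have hint : Integrable (fun p : E × E => (K (p.1 - p.2) • fderiv ℝ ψ p.1) (b p.2))
      (vol.prod ρ) := by
    refine integrable_clm_apply_snd hb hb1 (by fun_prop : Continuous _).aestronglyMeasurable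
      ((hdc.integrable_of_hasCompactSupport hds).norm.const_mul M) fun p => ?_
    rw [norm_smul, Real.norm_of_nonneg (hK.pos _).le]
    exact mul_le_mul_of_nonneg_right (hK.le _) (norm_nonneg _)
  have hint' : Integrable (fun p : E × E => (K p.1 • fderiv ℝ ψ (p.1 + p.2)) (b p.2))
      (vol.prod ρ) := by
    refine integrable_clm_apply_snd hb hb1 (by fun_prop : Continuous _).aestronglyMeasurable
      (hKi.mul_const A) fun p => ?_
    rw [norm_smul, Real.norm_of_nonneg (hK.pos _).le]
    exact mul_le_mul_of_nonneg_left (hA _) (hK.pos _).le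
  have htranslate : ∀ y, ∫ z, fderiv ℝ ψ (y + z) (b z) ∂ρ = 0 := fun y => by
    simpa only [fderiv_comp_add_left] using hdiv (fun z => ψ (y + z)) (by fun_prop)
      (hψ'.comp_homeomorph (Homeomorph.addLeft y))
  calc ∫ x, fderiv ℝ ψ x (mollify K ρ b x) ∂vol
      = ∫ x, ∫ z, (K (x - z) • fderiv ℝ ψ x) (b z) ∂ρ ∂vol := by
        refine integral_congr_ae (ae_of_all _ fun x => ?_)
        simp only [mollify, ← (fderiv ℝ ψ x).integral_comp_comm (hK.integrable_sub_smul hb hb1 x),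
          map_smul, smul_apply]
    _ = ∫ z, ∫ x, (K (x - z) • fderiv ℝ ψ x) (b z) ∂vol ∂ρ := integral_integral_swap hint
    _ = ∫ z, ∫ y, (K y • fderiv ℝ ψ (y + z)) (b z) ∂vol ∂ρ := by
        refine integral_congr_ae (ae_of_all _ fun z => ?_)
        simp only [← integral_add_right_eq_self (fun x => (K (x - z) • fderiv ℝ ψ x) (b z)) z,
          add_sub_cancel_right]
    _ = ∫ y, ∫ z, (K y • fderiv ℝ ψ (y + z)) (b z) ∂ρ ∂vol := (integral_integral_swap hint').symm
    _ = 0 := by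
        simp only [smul_apply, integral_smul, htranslate, smul_zero,
          integral_zero]

variable [NeZero ρ]

theorem IsLogLipschitzKernel.isLipschitzDivFree_mollifiedField (hK : IsLogLipschitzKernel K C M)
    (hKi : Integrable K vol) (hb : AEStronglyMeasurable b ρ) (hb1 : ∀ᵐ x ∂ρ, ‖b x‖ ≤ 1)
    (hdiv : IsDivFree ρ b) :
    IsLipschitzDivFree (ρ.conv (vol.withDensity fun x => ENNReal.ofReal (K x)))
      (mollifiedField K ρ b) := fun u D hu hu' => by
  obtain ⟨L, hL⟩ := hK.exists_lipschitzWith_mollify hb hb1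
  have hrm : Measurable (mollifiedDensity K ρ) := hK.continuous_mollifiedDensity.measurable
  rw [hK.conv_withDensity_ofReal ρ vol, integral_withDensity_eq_integral_toReal_smul (by fun_prop)
    (ae_of_all _ fun x => ENNReal.ofReal_lt_top),
    ← isLipschitzDivFree_of_lipschitzWith hL (hK.isDivFree_mollify hKi hb hb1 hdiv) u D hu hu']
  refine integral_congr_ae (ae_of_all _ fun x => ?_)
  simp only [← hK.mollifiedDensity_smul_mollifiedField, map_smul,
    ENNReal.toReal_ofReal (hK.mollifiedDensity_pos x).le]

end Mollification

theorem exists_mollification [FiniteDimensional ℝ E] [BorelSpace E] (ρ : Measure E)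
    [IsFiniteMeasure ρ] [NeZero ρ] {b : E → E} (hb : StronglyMeasurable b)
    (hb1 : ∀ᵐ x ∂ρ, ‖b x‖ ≤ 1) (hdiv : IsDivFree ρ b) :
    ∃ κ : Measure E, IsProbabilityMeasure κ ∧ ∀ ε : ℝ, 0 < ε → ∃ (V : E → E) (L : ℝ≥0),
      LipschitzWith L V ∧ (∀ x, ‖V x‖ ≤ 1) ∧
      ρ.conv (κ.map fun x => ε • x) ≪ Measure.addHaar ∧
      IsLipschitzDivFree (ρ.conv (κ.map fun x => ε • x)) V ∧
      ∀ c : E → E, StronglyMeasurable c →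
        ∫⁻ x, ‖V x - c x‖ₑ ∂(ρ.conv (κ.map fun x => ε • x)) ≤
          ∫⁻ z, ∫⁻ y, ‖b z - c (z + ε • y)‖ₑ ∂κ ∂ρ := by
  obtain ⟨κ, hκ, hkernel⟩ := exists_isLogLipschitzKernel (Measure.addHaar : Measure E)
  refine ⟨κ, hκ, fun ε hε => ?_⟩
  obtain ⟨K, C, M, hK, hmap⟩ := hkernel ε hε
  have hmeas : Measurable fun x : E => ε • x := measurable_const_smul ε
  have hb' : AEStronglyMeasurable b ρ := hb.aestronglyMeasurable
  have hKi : Integrable K Measure.addHaar := by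
    refine ⟨hK.continuous.aestronglyMeasurable, ?_⟩
    have := Measure.isProbabilityMeasure_map (μ := κ) hmeas.aemeasurable
    have hfin := measure_lt_top (κ.map fun x => ε • x) Set.univ
    rwa [hmap, withDensity_apply _ MeasurableSet.univ, Measure.restrict_univ,
      ← hasFiniteIntegral_iff_ofReal (ae_of_all _ fun x => (hK.pos x).le)] at hfin
  refine ⟨mollifiedField K ρ b, _, hK.lipschitzWith_mollifiedField hb' hb1,
    hK.norm_mollifiedField_le hb1, ?_, ?_, fun c hc => ?_⟩
  · rw [hmap, hK.conv_withDensity_ofReal ρ Measure.addHaar]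
    exact withDensity_absolutelyContinuous _ _
  · rw [hmap]
    exact hK.isLipschitzDivFree_mollifiedField hKi hb' hb1 hdiv
  · calc ∫⁻ x, ‖mollifiedField K ρ b x - c x‖ₑ ∂(ρ.conv (κ.map fun x => ε • x))
        ≤ ∫⁻ z, ∫⁻ y, ‖b z - c (z + y)‖ₑ ∂(κ.map fun x => ε • x) ∂ρ := by
          rw [hmap]
          exact hK.lintegral_enorm_mollifiedField_sub_le ρ Measure.addHaar hb hb1 hc
      _ = _ := lintegral_congr fun z => lintegral_map
          (stronglyMeasurable_const.sub (hc.comp_measurable (measurable_const_add z))).enorm hmeas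

end DivergenceFree

section Flow

/-- `X` is the flow of the autonomous vector field `V` for times in `(-T, T)`. -/
structure IsFlowOn {E : Type*} [NormedAddCommGroup E] [NormedSpace ℝ E] (V : E → E) (T : ℝ)
    (X : ℝ → E → E) : Prop where
  zero (x : E) : X 0 x = x
  hasDerivAt (x : E) {t : ℝ} (ht : t ∈ Set.Ioo (-T) T) :
    HasDerivAt (fun s => X s x) (V (X t x)) t

variable {E : Type*} [NormedAddCommGroup E] [NormedSpace ℝ E] {V : E → E} {L : ℝ≥0} {T : ℝ}
  {X : ℝ → E → E}

theorem exists_isFlowOn [CompleteSpace E] (hV : LipschitzWith L V) (hV1 : ∀ x, ‖V x‖ ≤ 1)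
    (hT : 0 ≤ T) : ∃ X, IsFlowOn V T X := by
  have h0 : (0 : ℝ) ∈ Set.Icc (-T) T := ⟨neg_nonpos.2 hT, hT⟩
  have hPL (x : E) : IsPicardLindelof (fun _ : ℝ => V) ⟨0, h0⟩ x T.toNNReal 0 1 L :=
    { lipschitzOnWith := fun _ _ => hV.lipschitzOnWith
      continuousOn := fun _ _ => continuousOn_const
      norm_le := fun _ _ y _ => by simpa using hV1 y
      mul_max_le := by simp [hT] }
  choose α hα0 hα using fun x => (hPL x).exists_eq_forall_mem_Icc_hasDerivWithinAt₀
  exact ⟨fun t x => α x t, hα0, fun x t ht =>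
    (hα x t (Set.Ioo_subset_Icc_self ht)).hasDerivAt (Icc_mem_nhds ht.1 ht.2)⟩

namespace IsFlowOn

theorem neg (hX : IsFlowOn V T X) : IsFlowOn (-V) T fun t => X (-t) where
  zero x := by rw [neg_zero, hX.zero]
  hasDerivAt x t ht := by
    have hderiv := hX.hasDerivAt x (t := -t) ⟨neg_lt_neg ht.2, neg_lt.2 ht.1⟩
    simpa [Function.comp_def] using hderiv.scomp t (hasDerivAt_neg t)

theorem add (hX : IsFlowOn V T X) (hV : LipschitzWith L V) {s t : ℝ} (hs : s ∈ Set.Ioo (-T) T)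
    (ht : t ∈ Set.Ioo (-T) T) (hst : s + t ∈ Set.Ioo (-T) T) (x : E) :
    X (s + t) x = X t (X s x) := by
  have hmem (r : ℝ) : r ∈ Set.Ioo (max (-T) (-T - s)) (min T (T - s)) ↔
      r ∈ Set.Ioo (-T) T ∧ s + r ∈ Set.Ioo (-T) T := by
    simp only [Set.mem_Ioo, max_lt_iff, lt_min_iff]
    grind
  refine ODE_solution_unique_of_mem_Ioo (v := fun _ => V) (s := fun _ => Set.univ) (t₀ := 0)
    (fun _ _ => hV.lipschitzOnWith) ((hmem 0).2 ⟨?_, by rwa [add_zero]⟩)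
    (fun r hr => ⟨(hX.hasDerivAt x ((hmem r).1 hr).2).comp_const_add s r, Set.mem_univ _⟩)
    (fun r hr => ⟨hX.hasDerivAt (X s x) ((hmem r).1 hr).1, Set.mem_univ _⟩)
    (by rw [add_zero, hX.zero]) ((hmem t).2 ⟨ht, hst⟩)
  exact ⟨by linarith [hs.1, hs.2], by linarith [hs.1, hs.2]⟩

theorem lipschitzOnWith_time (hX : IsFlowOn V T X) (hV1 : ∀ x, ‖V x‖ ≤ 1) (x : E) :
    LipschitzOnWith 1 (fun t => X t x) (Set.Ioo (-T) T) :=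
  (convex_Ioo (-T) T).lipschitzOnWith_of_nnnorm_hasDerivWithin_le
    (fun _ ht => (hX.hasDerivAt x ht).hasDerivWithinAt) fun _ _ => hV1 _

theorem dist_le (hX : IsFlowOn V T X) (hV : LipschitzWith L V) {t : ℝ} (ht : t ∈ Set.Ico 0 T)
    (x y : E) : dist (X t x) (X t y) ≤ dist x y * Real.exp (L * t) := by
  have hsub : Set.Icc 0 t ⊆ Set.Ioo (-T) T := fun r hr =>
    ⟨(neg_lt_zero.2 (ht.1.trans_lt ht.2)).trans_le hr.1, hr.2.trans_lt ht.2⟩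
  have hcont (z : E) : ContinuousOn (fun s => X s z) (Set.Icc 0 t) := fun r hr =>
    (hX.hasDerivAt z (hsub hr)).continuousAt.continuousWithinAt
  have hderiv (z : E) (r : ℝ) (hr : r ∈ Set.Ico 0 t) :
      HasDerivWithinAt (fun s => X s z) (V (X r z)) (Set.Ici r) r :=
    (hX.hasDerivAt z (hsub (Set.Ico_subset_Icc_self hr))).hasDerivWithinAt
  simpa only [sub_zero] using dist_le_of_trajectories_ODE (fun _ => hV) (hcont x) (hderiv x)
    (hcont y) (hderiv y) (by simp only [hX.zero, le_refl]) t ⟨ht.1, le_rfl⟩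

theorem lipschitzWith (hX : IsFlowOn V T X) (hV : LipschitzWith L V) {t : ℝ}
    (ht : t ∈ Set.Ioo (-T) T) : LipschitzWith (Real.exp (L * |t|)).toNNReal (X t) := by
  refine LipschitzWith.of_dist_le_mul fun x y => ?_
  rw [Real.coe_toNNReal _ (Real.exp_pos _).le, mul_comm]
  rcases le_total 0 t with h0 | h0
  · rw [abs_of_nonneg h0]
    exact hX.dist_le hV ⟨h0, ht.2⟩ x y
  · rw [abs_of_nonpos h0]
    simpa only [neg_neg] using hX.neg.dist_le hV.neg ⟨neg_nonneg.2 h0, neg_lt.2 ht.1⟩ x y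

theorem dist_self_le (hX : IsFlowOn V T X) (hV1 : ∀ x, ‖V x‖ ≤ 1) {t : ℝ}
    (ht : t ∈ Set.Ioo (-T) T) (x : E) : dist x (X t x) ≤ |t| := by
  have h0 : (0 : ℝ) ∈ Set.Ioo (-T) T := by constructor <;> linarith [ht.1, ht.2]
  simpa [hX.zero] using (hX.lipschitzOnWith_time hV1 x).dist_le_mul 0 h0 t ht

theorem hasCompactSupport_comp [ProperSpace E] (hX : IsFlowOn V T X) (hV1 : ∀ x, ‖V x‖ ≤ 1)
    {t : ℝ} (ht : t ∈ Set.Ioo (-T) T) {ψ : E → ℝ} (hψ : HasCompactSupport ψ) :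
    HasCompactSupport fun x => ψ (X t x) := by
  refine HasCompactSupport.intro (hψ.isCompact.cthickening (r := |t|)) fun x hx => ?_
  by_contra hne
  exact hx (Metric.mem_cthickening_of_dist_le x _ _ _ (subset_tsupport _ hne)
    (hX.dist_self_le hV1 ht x))

variable [FiniteDimensional ℝ E] [MeasurableSpace E] [BorelSpace E] {σ : Measure E}
  [IsFiniteMeasure σ]

theorem hasDerivAt_integral_zero (hX : IsFlowOn V T X) (hV : LipschitzWith L V)
    (hV1 : ∀ x, ‖V x‖ ≤ 1) (hT : 0 < T) (hσ : σ ≪ Measure.addHaar) {u : E → ℝ} {D : ℝ≥0}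
    (hu : LipschitzWith D u) (hu' : HasCompactSupport u) :
    HasDerivAt (fun s => ∫ x, u (X s x) ∂σ) (∫ x, fderiv ℝ u x (V x) ∂σ) 0 := by
  have h0 : (0 : ℝ) ∈ Set.Ioo (-T) T := ⟨neg_lt_zero.2 hT, hT⟩
  have hnhds : Set.Ioo (-T) T ∈ nhds (0 : ℝ) := Ioo_mem_nhds h0.1 h0.2
  refine (hasDerivAt_integral_of_dominated_loc_of_lip (bound := fun _ => (D : ℝ)) hnhds ?_ ?_ ?_ ?_
    (integrable_const _) ?_).2
  · filter_upwards [hnhds] with s hs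
    exact (hu.continuous.comp (hX.lipschitzWith hV hs).continuous).aestronglyMeasurable
  · simpa only [hX.zero] using hu.continuous.integrable_of_hasCompactSupport hu'
  · exact isBoundedBilinearMap_apply.continuous.comp_aestronglyMeasurable
      ((measurable_fderiv ℝ u).aestronglyMeasurable.prodMk hV.continuous.aestronglyMeasurable)
  · refine ae_of_all _ fun x => ?_
    rw [Real.nnabs_of_nonneg D.coe_nonneg, Real.toNNReal_coe]
    simpa only [mul_one, Function.comp_def] using
      hu.comp_lipschitzOnWith (hX.lipschitzOnWith_time hV1 x)
  · filter_upwards [hσ.ae_le hu.ae_differentiableAt] with x hx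
    rw [← hX.zero x] at hx
    simpa only [Function.comp_def, hX.zero] using
      hx.hasFDerivAt.comp_hasDerivAt 0 (hX.hasDerivAt x h0)

theorem integral_comp_eq (hX : IsFlowOn V T X) (hV : LipschitzWith L V)
    (hV1 : ∀ x, ‖V x‖ ≤ 1) (hσ : σ ≪ Measure.addHaar) (hdiv : IsLipschitzDivFree σ V) {ψ : E → ℝ}
    {D : ℝ≥0} (hψ : LipschitzWith D ψ) (hψ' : HasCompactSupport ψ) {t : ℝ}
    (ht : t ∈ Set.Ioo (-T) T) : ∫ x, ψ (X t x) ∂σ = ∫ x, ψ x ∂σ := by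
  have hT : 0 < T := by linarith [ht.1, ht.2]
  have h0 : (0 : ℝ) ∈ Set.Ioo (-T) T := ⟨neg_lt_zero.2 hT, hT⟩
  have hderiv (s : ℝ) (hs : s ∈ Set.Ioo (-T) T) :
      HasDerivAt (fun r => ∫ x, ψ (X r x) ∂σ) 0 s := by
    have hus : LipschitzWith _ fun x => ψ (X s x) := hψ.comp (hX.lipschitzWith hV hs)
    have hus' := hX.hasCompactSupport_comp hV1 hs hψ'
    have h : HasDerivAt (fun r => ∫ x, ψ (X s (X r x)) ∂σ) 0 (s - s) := by
      simpa only [sub_self, hdiv _ _ hus hus'] using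
        hX.hasDerivAt_integral_zero hV hV1 hT hσ hus hus'
    refine HasDerivAt.congr_of_eventuallyEq (h.comp_sub_const s s) ?_
    have hnhds : ∀ᶠ r in nhds s, r - s ∈ Set.Ioo (-T) T := by
      refine (continuous_sub_right s).continuousAt.eventually (Ioo_mem_nhds ?_ ?_) <;> simp [hT]
    filter_upwards [hnhds, Ioo_mem_nhds hs.1 hs.2] with r hrs hr
    have hadd := hX.add hV hrs hs (by rwa [sub_add_cancel])
    simp only [sub_add_cancel] at hadd
    simp only [hadd]
  have := isOpen_Ioo.is_const_of_deriv_eq_zero (convex_Ioo (-T) T).isPreconnected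
    (fun s hs => (hderiv s hs).differentiableAt.differentiableWithinAt)
    (fun s hs => (hderiv s hs).deriv) ht h0
  simpa only [hX.zero] using this

end IsFlowOn

section LipschitzSeparate

theorem hasCompactSupport_thickenedIndicator {Y : Type*} [PseudoMetricSpace Y] [ProperSpace Y]
    {δ : ℝ} (hδ : 0 < δ) {F : Set Y} (hF : IsCompact F) :
    HasCompactSupport fun x => (thickenedIndicator hδ F x : ℝ) := by
  refine HasCompactSupport.intro (hF.cthickening (r := δ)) fun x hx => ?_
  rw [thickenedIndicator_zero hδ F fun h => hx (Metric.thickening_subset_cthickening δ F h),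
    NNReal.coe_zero]

theorem measure_ext_of_forall_integral_lipschitzWith_eq {Y : Type*} [MetricSpace Y]
    [ProperSpace Y] [MeasurableSpace Y] [BorelSpace Y] {σ τ : Measure Y} [IsFiniteMeasure σ]
    [IsFiniteMeasure τ] (h : ∀ (u : Y → ℝ) (D : ℝ≥0), LipschitzWith D u → HasCompactSupport u →
      ∫ x, u x ∂σ = ∫ x, u x ∂τ) : σ = τ := by
  have hcompact {F : Set Y} (hF : IsCompact F) : σ F = τ F := by
    have hδ (k : ℕ) : (0 : ℝ) < 1 / ((k : ℝ) + 1) := by positivity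
    have hlim := tendsto_one_div_add_atTop_nhds_zero_nat (𝕜 := ℝ)
    refine (measureReal_eq_measureReal_iff (by finiteness) (by finiteness)).1 (tendsto_nhds_unique
      (tendsto_integral_thickenedIndicator_of_isClosed σ hF.isClosed hδ hlim)
      ((tendsto_integral_thickenedIndicator_of_isClosed τ hF.isClosed hδ hlim).congr fun k => ?_))
    exact (h _ _ (lipschitzWith_thickenedIndicator (hδ k) F)
      (hasCompactSupport_thickenedIndicator (hδ k) hF)).symm
  ext A hA
  rw [hA.measure_eq_iSup_isCompact_of_ne_top (measure_ne_top σ A),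
    hA.measure_eq_iSup_isCompact_of_ne_top (measure_ne_top τ A)]
  exact iSup_congr fun F => iSup_congr fun _ => iSup_congr hcompact

end LipschitzSeparate

theorem IsFlowOn.map_eq [FiniteDimensional ℝ E] [MeasurableSpace E] [BorelSpace E] {σ : Measure E}
    [IsFiniteMeasure σ] (hX : IsFlowOn V T X) (hV : LipschitzWith L V) (hV1 : ∀ x, ‖V x‖ ≤ 1)
    (hσ : σ ≪ Measure.addHaar) (hdiv : IsLipschitzDivFree σ V) {t : ℝ} (ht : t ∈ Set.Ioo (-T) T) :
    σ.map (X t) = σ := by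
  refine measure_ext_of_forall_integral_lipschitzWith_eq fun ψ D hψ hψ' => ?_
  rw [integral_map (hX.lipschitzWith hV ht).continuous.aemeasurable
    hψ.continuous.aestronglyMeasurable, hX.integral_comp_eq hV hV1 hσ hdiv hψ hψ' ht]

end Flow

section CurveSpace

/-- The continuous curves `[0, ℓ] → E`, with the topology of uniform convergence. -/
abbrev Curve (ℓ : ℝ) (E : Type*) [TopologicalSpace E] : Type _ :=
  C(Set.Icc (0 : ℝ) ℓ, E)

namespace Curve

variable {E : Type*} [NormedAddCommGroup E] {ℓ : ℝ} (hℓ : 0 ≤ ℓ)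

theorem continuous_uncurry_IccExtend :
    Continuous fun p : Curve ℓ E × ℝ => Set.IccExtend hℓ p.1 p.2 :=
  continuous_fst.eval (continuous_projIcc.comp continuous_snd)

theorem continuous_IccExtend (γ : Curve ℓ E) : Continuous (Set.IccExtend hℓ γ) :=
  γ.continuous.Icc_extend'

theorem isCompact_setOf_lipschitzWith_one [ProperSpace E] (t₀ : Set.Icc (0 : ℝ) ℓ) {K : Set E}
    (hK : IsCompact K) : IsCompact {γ : Curve ℓ E | LipschitzWith 1 γ ∧ γ t₀ ∈ K} := by
  refine ArzelaAscoli.isCompact_of_equicontinuous _ ?_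
    (LipschitzWith.uniformEquicontinuous _ 1 fun γ => γ.2.1).equicontinuous
  have himage : ContinuousMap.toFun '' {γ : Curve ℓ E | LipschitzWith 1 γ ∧ γ t₀ ∈ K} =
      {f | LipschitzWith 1 f} ∩ {f | f t₀ ∈ K} := by
    ext f
    exact ⟨fun ⟨_, hγ, hf⟩ => hf ▸ hγ, fun hf => ⟨⟨f, hf.1.continuous⟩, hf, rfl⟩⟩
  rw [himage]
  refine (isCompact_univ_pi fun t => hK.cthickening (r := dist t t₀)).of_isClosed_subset
    ((isClosed_setOfPred_lipschitzWith 1).inter (hK.isClosed.preimage (continuous_apply t₀)))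
    fun f ⟨hf, hf₀⟩ t _ => ?_
  exact Metric.mem_cthickening_of_dist_le _ _ _ K hf₀ (by simpa using hf.dist_le_mul t t₀)

section Measurable

variable [MeasurableSpace E] [BorelSpace E] [MeasurableSpace (Curve ℓ E)] [BorelSpace (Curve ℓ E)]

theorem measurable_eval (t : Set.Icc (0 : ℝ) ℓ) : Measurable fun γ : Curve ℓ E => γ t :=
  (continuous_eval_const t).measurable

theorem isTightMeasureSet_of_ae_lipschitzWith_one [ProperSpace E] (t₀ : Set.Icc (0 : ℝ) ℓ)
    {S : Set (Measure (Curve ℓ E))} (hS : ∀ η ∈ S, ∀ᵐ γ : Curve ℓ E ∂η, LipschitzWith 1 γ)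
    (hS₀ : IsTightMeasureSet ((fun η : Measure (Curve ℓ E) => η.map fun γ => γ t₀) '' S)) :
    IsTightMeasureSet S := by
  rw [isTightMeasureSet_iff_exists_isCompact_measure_compl_le] at hS₀ ⊢
  intro δ hδ
  obtain ⟨K, hK, hKδ⟩ := hS₀ δ hδ
  refine ⟨_, isCompact_setOf_lipschitzWith_one t₀ hK, fun η hη => ?_⟩
  have hle := hKδ _ (Set.mem_image_of_mem _ hη)
  rw [Measure.map_apply (measurable_eval t₀) hK.measurableSet.compl] at hle
  refine (measure_mono_ae ((hS η hη).mono fun γ hγ hmem hγK => ?_)).trans hle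
  exact hmem ⟨hγ, hγK⟩

theorem measurable_uncurry_IccExtend :
    Measurable fun p : Curve ℓ E × ℝ => Set.IccExtend hℓ p.1 p.2 :=
  (continuous_uncurry_IccExtend hℓ).measurable

/-- The occupation measure of a curve: the time it spends in each set. -/
noncomputable def occupation : ProbabilityTheory.Kernel (Curve ℓ E) E where
  toFun γ := (volume.restrict (Set.Icc 0 ℓ)).map (Set.IccExtend hℓ γ)
  measurable' := by
    refine Measure.measurable_of_measurable_coe _ fun A hA => ?_
    simp only [Measure.map_apply (continuous_IccExtend hℓ _).measurable hA]
    exact measurable_measure_prodMk_left (measurable_uncurry_IccExtend hℓ hA)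

theorem occupation_apply (γ : Curve ℓ E) :
    occupation hℓ γ = (volume.restrict (Set.Icc 0 ℓ)).map (Set.IccExtend hℓ γ) :=
  rfl

instance isFiniteMeasure_occupation (γ : Curve ℓ E) : IsFiniteMeasure (occupation hℓ γ) := by
  rw [occupation_apply]
  infer_instance

theorem occupation_univ (γ : Curve ℓ E) : occupation hℓ γ Set.univ = ENNReal.ofReal ℓ := by
  rw [occupation_apply, Measure.map_apply (continuous_IccExtend hℓ γ).measurable MeasurableSet.univ,
    Set.preimage_univ, Measure.restrict_apply_univ, Real.volume_Icc, sub_zero]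

theorem integrable_occupation_iff {F : Type*} [NormedAddCommGroup F] {f : E → F}
    (hf : StronglyMeasurable f) {γ : Curve ℓ E} : Integrable f (occupation hℓ γ) ↔
      IntegrableOn (fun s => f (Set.IccExtend hℓ γ s)) (Set.Icc 0 ℓ) :=
  integrable_map_measure hf.aestronglyMeasurable (continuous_IccExtend hℓ γ).aemeasurable

theorem intervalIntegrable_of_integrable_occupation {F : Type*} [NormedAddCommGroup F] {f : E → F}
    (hf : StronglyMeasurable f) {γ : Curve ℓ E} (hfγ : Integrable f (occupation hℓ γ))
    {r t : ℝ} (hr : r ∈ Set.Icc 0 ℓ) (ht : t ∈ Set.Icc 0 ℓ) :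
    IntervalIntegrable (fun s => f (Set.IccExtend hℓ γ s)) volume r t :=
  IntegrableOn.intervalIntegrable
    (((integrable_occupation_iff hℓ hf).1 hfγ).mono_set (Set.uIcc_subset_Icc hr ht))

theorem lintegral_occupation {f : E → ℝ≥0∞} (hf : Measurable f) (γ : Curve ℓ E) :
    ∫⁻ x, f x ∂occupation hℓ γ = ∫⁻ s in Set.Icc 0 ℓ, f (Set.IccExtend hℓ γ s) :=
  lintegral_map hf (continuous_IccExtend hℓ γ).measurable

theorem occupation_comp_eq_smul {η : Measure (Curve ℓ E)} [SFinite η] {ρ : Measure E}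
    (hη : ∀ t, η.map (fun γ => γ t) = ρ) :
    η.bind (occupation hℓ) = ENNReal.ofReal ℓ • ρ := by
  refine Measure.ext_of_lintegral _ fun f hf => ?_
  have hmarginal (s : ℝ) : ∫⁻ γ, f (Set.IccExtend hℓ γ s) ∂η = ∫⁻ x, f x ∂ρ := by
    rw [← hη (Set.projIcc 0 ℓ hℓ s), lintegral_map hf (measurable_eval _)]
    rfl
  have hmeas : Measurable fun p : Curve ℓ E × ℝ => f (Set.IccExtend hℓ p.1 p.2) :=
    hf.comp (measurable_uncurry_IccExtend hℓ)
  rw [Measure.lintegral_bind (occupation hℓ).aemeasurable hf.aemeasurable, lintegral_smul_measure,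
    lintegral_congr (lintegral_occupation hℓ hf), lintegral_lintegral_swap hmeas.aemeasurable,
    lintegral_congr hmarginal, setLIntegral_const, Real.volume_Icc, sub_zero, smul_eq_mul, mul_comm]

theorem ae_integrable_occupation {η : Measure (Curve ℓ E)} [SFinite η] {ρ : Measure E}
    (hη : ∀ t, η.map (fun γ => γ t) = ρ) {F : Type*} [NormedAddCommGroup F] {f : E → F}
    (hf : Integrable f ρ) : ∀ᵐ γ ∂η, Integrable f (occupation hℓ γ) := by
  refine Measure.ae_integrable_of_integrable_comp ?_
  rw [occupation_comp_eq_smul hℓ hη]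
  exact hf.smul_measure ENNReal.ofReal_ne_top

end Measurable

end Curve

end CurveSpace

section Superposition

variable {E : Type*} [NormedAddCommGroup E] [NormedSpace ℝ E] {ℓ : ℝ} (hℓ : 0 ≤ ℓ) {b c : E → E}

/-- The failure at time `t` of `γ` to solve the integral form of the differential equation
`γ' = b ∘ γ`. -/
noncomputable def solutionDefect (b : E → E) (t : Set.Icc (0 : ℝ) ℓ) (γ : Curve ℓ E) : E :=
  γ t - γ ⟨0, Set.left_mem_Icc.2 hℓ⟩ - ∫ s in 0..t, b (Set.IccExtend hℓ γ s)

/-- `γ` is a solution of the differential equation `γ' = b ∘ γ` in its integral form. -/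
def IsIntegralSolution (b : E → E) (γ : Curve ℓ E) : Prop :=
  ∀ t, solutionDefect hℓ b t γ = 0

theorem continuous_solutionDefect (hc : Continuous c) (t : Set.Icc (0 : ℝ) ℓ) :
    Continuous (solutionDefect hℓ c t) := by
  have hprim : Continuous fun γ : Curve ℓ E => ∫ s in 0..t, c (Set.IccExtend hℓ γ s) :=
    intervalIntegral.continuous_parametric_intervalIntegral_of_continuous'
      (f := fun (γ : Curve ℓ E) s => c (Set.IccExtend hℓ γ s))
      (hc.comp (Curve.continuous_uncurry_IccExtend hℓ)) _ _
  exact ((continuous_eval_const t).sub (continuous_eval_const _)).sub hprim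

variable [MeasurableSpace E] [BorelSpace E]

theorem IsIntegralSolution.lipschitzWith_one {γ : Curve ℓ E} (hγ : IsIntegralSolution hℓ b γ)
    (hb : StronglyMeasurable b) (hb1 : ∀ x, ‖b x‖ ≤ 1) : LipschitzWith 1 γ := by
  have hbγ (s t : ℝ) : IntervalIntegrable (fun s => b (Set.IccExtend hℓ γ s)) volume s t :=
    (intervalIntegrable_const (c := (1 : ℝ))).mono_fun'
      (hb.comp_measurable (Curve.continuous_IccExtend hℓ γ).measurable).aestronglyMeasurable
      (ae_of_all _ fun _ => hb1 _)
  refine LipschitzWith.of_dist_le_mul fun s t => ?_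
  have hsub : γ s - γ t = ∫ r in t..s, b (Set.IccExtend hℓ γ r) := by
    rw [← intervalIntegral.integral_interval_sub_left (hbγ 0 s) (hbγ 0 t),
      ← sub_eq_zero.1 (hγ s), ← sub_eq_zero.1 (hγ t), sub_sub_sub_cancel_right]
  rw [dist_eq_norm, hsub, Subtype.dist_eq, Real.dist_eq]
  simpa using intervalIntegral.norm_integral_le_of_norm_le_const fun r _ => hb1 _

variable [MeasurableSpace (Curve ℓ E)] [BorelSpace (Curve ℓ E)]

theorem measurable_solutionDefect [SecondCountableTopology E] (hb : StronglyMeasurable b)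
    (t : Set.Icc (0 : ℝ) ℓ) : Measurable (solutionDefect hℓ b t) := by
  have hprim : StronglyMeasurable fun γ : Curve ℓ E =>
      ∫ s in Set.Ioc 0 t.1, b (Set.IccExtend hℓ γ s) :=
    StronglyMeasurable.integral_prod_right (f := fun (γ : Curve ℓ E) s => b (Set.IccExtend hℓ γ s))
      (hb.comp_measurable (Curve.measurable_uncurry_IccExtend hℓ))
  simp only [← intervalIntegral.integral_of_le t.2.1] at hprim
  exact ((Curve.measurable_eval t).sub (Curve.measurable_eval _)).sub hprim.measurable

theorem enorm_solutionDefect_sub_le (hb : StronglyMeasurable b)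
    (hc : StronglyMeasurable c) {γ : Curve ℓ E} (hbγ : Integrable b (Curve.occupation hℓ γ))
    (hcγ : Integrable c (Curve.occupation hℓ γ)) (t : Set.Icc (0 : ℝ) ℓ) :
    ‖solutionDefect hℓ b t γ - solutionDefect hℓ c t γ‖ₑ ≤
      ∫⁻ x, ‖b x - c x‖ₑ ∂Curve.occupation hℓ γ := by
  have h0 : (0 : ℝ) ∈ Set.Icc 0 ℓ := Set.left_mem_Icc.2 hℓ
  have hbc : StronglyMeasurable fun x => b x - c x := hb.sub hc
  rw [Curve.lintegral_occupation hℓ hbc.enorm, enorm_sub_rev, solutionDefect,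
    solutionDefect, sub_sub_sub_cancel_left, ← intervalIntegral.integral_sub
    (Curve.intervalIntegrable_of_integrable_occupation hℓ hb hbγ h0 t.2)
    (Curve.intervalIntegrable_of_integrable_occupation hℓ hc hcγ h0 t.2),
    intervalIntegral.integral_of_le t.2.1]
  exact (enorm_integral_le_lintegral_enorm _).trans (lintegral_mono_set
    (Set.Ioc_subset_Icc_self.trans (Set.Icc_subset_Icc_right t.2.2)))

section Marginals

variable {ρ : Measure E} {η : Measure (Curve ℓ E)} [SFinite η] (hη : ∀ t, η.map (fun γ => γ t) = ρ)
include hη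

theorem lintegral_enorm_solutionDefect_sub_le (hb : StronglyMeasurable b)
    (hc : StronglyMeasurable c) (hbρ : Integrable b ρ) (hcρ : Integrable c ρ)
    (t : Set.Icc (0 : ℝ) ℓ) :
    ∫⁻ γ, ‖solutionDefect hℓ b t γ - solutionDefect hℓ c t γ‖ₑ ∂η ≤
      ENNReal.ofReal ℓ * ∫⁻ x, ‖b x - c x‖ₑ ∂ρ := by
  have hbc : StronglyMeasurable fun x => b x - c x := hb.sub hc
  rw [← smul_eq_mul, ← lintegral_smul_measure, ← Curve.occupation_comp_eq_smul hℓ hη,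
    Measure.lintegral_bind (Curve.occupation hℓ).aemeasurable hbc.enorm.aemeasurable]
  refine lintegral_mono_ae ?_
  filter_upwards [Curve.ae_integrable_occupation hℓ hη hbρ,
    Curve.ae_integrable_occupation hℓ hη hcρ] with γ hbγ hcγ
  exact enorm_solutionDefect_sub_le hℓ hb hc hbγ hcγ t

theorem ae_isIntegralSolution_of_forall_ae (hb : StronglyMeasurable b) (hbρ : Integrable b ρ)
    (hsol : ∀ t, ∀ᵐ γ ∂η, solutionDefect hℓ b t γ = 0) : ∀ᵐ γ ∂η, IsIntegralSolution hℓ b γ := by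
  obtain ⟨D, hD, hDdense⟩ := TopologicalSpace.exists_countable_dense (Set.Icc (0 : ℝ) ℓ)
  filter_upwards [(ae_ball_iff hD).2 fun t _ => hsol t, Curve.ae_integrable_occupation hℓ hη hbρ]
    with γ hγ hbγ
  have hprim : Continuous fun t : Set.Icc (0 : ℝ) ℓ =>
      ∫ s in 0..t.1, b (Set.IccExtend hℓ γ s) := by
    have hprimOn : ContinuousOn (fun t => ∫ s in 0..t, b (Set.IccExtend hℓ γ s))
        (Set.uIcc 0 ℓ) := by
      refine intervalIntegral.continuousOn_primitive_interval ?_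
      rw [Set.uIcc_of_le hℓ]
      exact (Curve.integrable_occupation_iff hℓ hb).1 hbγ
    rw [Set.uIcc_of_le hℓ] at hprimOn
    exact hprimOn.comp_continuous continuous_subtype_val fun t => t.2
  exact congrFun (((γ.continuous.sub continuous_const).sub hprim).ext_on hDdense
    continuous_const hγ)

end Marginals

/-- A measure on integral curves of `b` all of whose one-time marginals are `ρ`. It exhibits the
stationary solution `ρ` of the continuity equation `∂ₜ ρ + div (b ρ) = 0` as a superposition of
integral curves. -/
structure IsStationarySuperposition (ρ : Measure E) (b : E → E) (ζ : Measure (Curve ℓ E)) :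
    Prop where
  map_eval (t : Set.Icc (0 : ℝ) ℓ) : ζ.map (fun γ => γ t) = ρ
  ae_isIntegralSolution : ∀ᵐ γ ∂ζ, IsIntegralSolution hℓ b γ

section Marginals

variable {ρ : Measure E} {ζ : Measure (Curve ℓ E)}
  (hζ : IsStationarySuperposition hℓ ρ b ζ)
include hζ

namespace IsStationarySuperposition

theorem ae_forall_apply_mem {S : Set E} (hS : IsClosed S) (hρS : ∀ᵐ x ∂ρ, x ∈ S) :
    ∀ᵐ γ ∂ζ, ∀ t, γ t ∈ S := by
  obtain ⟨D, hD, hDdense⟩ := TopologicalSpace.exists_countable_dense (Set.Icc (0 : ℝ) ℓ)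
  have hmem (t : Set.Icc (0 : ℝ) ℓ) : ∀ᵐ γ ∂ζ, γ t ∈ S :=
    ae_of_ae_map (Curve.measurable_eval t).aemeasurable (by rwa [hζ.map_eval t])
  filter_upwards [(ae_ball_iff hD).2 fun t _ => hmem t] with γ hγ t
  exact (hS.preimage γ.continuous).closure_subset_iff.2 hγ (hDdense t)

variable [IsFiniteMeasure ρ]

theorem isFiniteMeasure : IsFiniteMeasure ζ := by
  have hmap := hζ.map_eval ⟨0, Set.left_mem_Icc.2 hℓ⟩
  constructor
  rw [← Set.preimage_univ, ← Measure.map_apply (Curve.measurable_eval _) MeasurableSet.univ, hmap]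
  exact measure_lt_top ρ _

theorem bind_occupation_eq_smul : ζ.bind (Curve.occupation hℓ) = ENNReal.ofReal ℓ • ρ := by
  have := hζ.isFiniteMeasure
  exact Curve.occupation_comp_eq_smul hℓ hζ.map_eval

theorem ae_ae_occupation {p : E → Prop} (hp : ∀ᵐ x ∂ρ, p x) :
    ∀ᵐ γ ∂ζ, ∀ᵐ x ∂Curve.occupation hℓ γ, p x := by
  have := hζ.isFiniteMeasure
  refine Measure.ae_ae_of_ae_comp ?_
  rw [hζ.bind_occupation_eq_smul]
  exact Measure.ae_smul_measure hp _

end IsStationarySuperposition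

end Marginals

theorem IsFlowOn.exists_isStationarySuperposition [FiniteDimensional ℝ E] {V : E → E} {L : ℝ≥0}
    {T : ℝ} {X : ℝ → E → E} (hX : IsFlowOn V T X) (hT : ℓ < T) (hV : LipschitzWith L V)
    (hV1 : ∀ x, ‖V x‖ ≤ 1) {σ : Measure E} [IsFiniteMeasure σ] (hσ : σ ≪ Measure.addHaar)
    (hdiv : IsLipschitzDivFree σ V) : ∃ η, IsStationarySuperposition hℓ σ V η := by
  have hmem {t : ℝ} (ht : t ∈ Set.Icc 0 ℓ) : t ∈ Set.Ioo (-T) T :=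
    ⟨by linarith [ht.1], ht.2.trans_lt hT⟩
  have hcont : Continuous fun p : E × Set.Icc (0 : ℝ) ℓ => X p.2 p.1 :=
    continuous_prod_of_continuous_lipschitzWith _ (Real.exp (L * ℓ)).toNNReal
      (fun x => ((hX.lipschitzOnWith_time hV1 x).continuousOn.comp_continuous
        continuous_subtype_val fun t => hmem t.2))
      fun t => (hX.lipschitzWith hV (hmem t.2)).weaken (by
        rw [abs_of_nonneg t.2.1]; gcongr; exact t.2.2)
  let Φ : E → Curve ℓ E := fun x => ⟨fun t => X t x, hcont.comp (.prodMk_right x)⟩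
  have hΦ : Continuous Φ := ContinuousMap.continuous_of_continuous_uncurry _ hcont
  have hsol (x : E) : IsIntegralSolution hℓ V (Φ x) := fun t => by
    have hderiv {s : ℝ} (hs : s ∈ Set.uIcc 0 t.1) :
        HasDerivAt (fun s => X s x) (V (Set.IccExtend hℓ (Φ x) s)) s := by
      have hs' : s ∈ Set.Icc 0 ℓ :=
        Set.Icc_subset_Icc_right t.2.2 (Set.uIcc_of_le t.2.1 ▸ hs)
      rw [Set.IccExtend_of_mem _ _ hs']
      exact hX.hasDerivAt x (hmem hs')
    rw [solutionDefect, intervalIntegral.integral_eq_sub_of_hasDerivAt (fun s => hderiv)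
      ((hV.continuous.comp (Curve.continuous_IccExtend hℓ _)).intervalIntegrable _ _)]
    exact sub_self _
  refine ⟨σ.map Φ, fun t => ?_, ?_⟩
  · rw [Measure.map_map (Curve.measurable_eval t) hΦ.measurable]
    exact hX.map_eq hV hV1 hσ hdiv (hmem t.2)
  · refine (ae_map_iff hΦ.measurable.aemeasurable ?_).2 (ae_of_all _ hsol)
    simp only [IsIntegralSolution, Set.ofPred_forall]
    exact (isClosed_iInter fun t => isClosed_eq
      (continuous_solutionDefect hℓ hV.continuous t) continuous_const).measurableSet

open Filter Topology

theorem lintegral_le_of_tendsto_finiteMeasure {Y ι : Type*} [TopologicalSpace Y]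
    [MeasurableSpace Y] [OpensMeasurableSpace Y] {F : Filter ι} [F.NeBot] {η : ι → FiniteMeasure Y}
    {ζ : FiniteMeasure Y} (hη : Tendsto η F (𝓝 ζ)) {f : Y → ℝ≥0} (hf : Continuous f)
    {J : ι → ℝ≥0∞} {I : ℝ≥0∞} (hJ : Tendsto J F (𝓝 I)) (hfJ : ∀ k, ∫⁻ y, f y ∂(η k) ≤ J k) :
    ∫⁻ y, f y ∂ζ ≤ I := by
  have htrunc (N : ℕ) : ∫⁻ y, (min N (f y) : ℝ≥0) ∂ζ ≤ I := by
    let g : BoundedContinuousFunction Y ℝ≥0 :=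
      .mkOfBound ⟨fun y => min (N : ℝ≥0) (f y), continuous_const.min hf⟩ N fun y z =>
        abs_sub_le_of_nonneg_of_le (NNReal.coe_nonneg _) (min_le_left _ _) (NNReal.coe_nonneg _)
          (min_le_left _ _)
    refine le_of_tendsto_of_tendsto' (FiniteMeasure.tendsto_iff_forall_lintegral_tendsto.1 hη g) hJ
      fun k => (lintegral_mono fun y => ?_).trans (hfJ k)
    exact ENNReal.coe_le_coe.2 (min_le_right _ _)
  refine le_of_tendsto' (lintegral_tendsto_of_tendsto_of_monotone
    (f := fun (N : ℕ) y => ((min (N : ℝ≥0) (f y) : ℝ≥0) : ℝ≥0∞))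
    (fun N => by fun_prop) (ae_of_all _ fun y N M hNM => by dsimp only; gcongr)
    (ae_of_all _ fun y => ?_)) htrunc
  obtain ⟨N, hN⟩ := exists_nat_ge (f y)
  refine tendsto_const_nhds.congr' ?_
  filter_upwards [eventually_ge_atTop N] with M hM
  rw [min_eq_right (hN.trans (by exact_mod_cast hM))]

section Limit

variable {ι : Type*} {F : Filter ι} [F.NeBot] {η : ι → FiniteMeasure (Curve ℓ E)}
  {ζ : FiniteMeasure (Curve ℓ E)} (hη : Tendsto η F (𝓝 ζ)) {σ : ι → FiniteMeasure E}
  {ρ : FiniteMeasure E} {V : ι → E → E} (hV : ∀ k, StronglyMeasurable (V k))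
  (hVσ : ∀ k, Integrable (V k) (σ k))
  (hηV : ∀ k, IsStationarySuperposition hℓ (σ k : Measure E) (V k) (η k))
include hη hV hVσ hηV

theorem lintegral_enorm_solutionDefect_le_of_tendsto (hc : Continuous c)
    (hcs : HasCompactSupport c) {J : ι → ℝ≥0∞} {I : ℝ≥0∞} (hJ : Tendsto J F (𝓝 I))
    (hVJ : ∀ k, ∫⁻ x, ‖V k x - c x‖ₑ ∂(σ k) ≤ J k) (t : Set.Icc (0 : ℝ) ℓ) :
    ∫⁻ γ, ‖solutionDefect hℓ c t γ‖ₑ ∂ζ ≤ ENNReal.ofReal ℓ * I := by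
  refine lintegral_le_of_tendsto_finiteMeasure hη (continuous_solutionDefect hℓ hc t).nnnorm
    (ENNReal.Tendsto.const_mul hJ (.inr ENNReal.ofReal_ne_top)) fun k => ?_
  calc ∫⁻ γ, ‖solutionDefect hℓ c t γ‖ₑ ∂(η k)
      = ∫⁻ γ, ‖solutionDefect hℓ (V k) t γ - solutionDefect hℓ c t γ‖ₑ ∂(η k) :=
        lintegral_congr_ae ((hηV k).ae_isIntegralSolution.mono fun γ hγ => by simp [hγ t])
    _ ≤ ENNReal.ofReal ℓ * ∫⁻ x, ‖V k x - c x‖ₑ ∂(σ k) :=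
        lintegral_enorm_solutionDefect_sub_le hℓ (hηV k).map_eval (hV k)
          (hc.stronglyMeasurable_of_hasCompactSupport hcs) (hVσ k)
          (hc.integrable_of_hasCompactSupport hcs) t
    _ ≤ ENNReal.ofReal ℓ * J k := by gcongr; exact hVJ k

/-- `V k` need not converge to `b`, which lives on another measure: closeness is measured through
common continuous approximations `c`. -/
theorem IsStationarySuperposition.of_tendsto [FiniteDimensional ℝ E] (hσ : Tendsto σ F (𝓝 ρ))
    (hb : StronglyMeasurable b) (hbρ : Integrable b ρ)
    (hVb : ∀ c : E → E, Continuous c → HasCompactSupport c → ∃ J : ι → ℝ≥0∞,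
      Tendsto J F (𝓝 (∫⁻ x, ‖b x - c x‖ₑ ∂ρ)) ∧ ∀ k, ∫⁻ x, ‖V k x - c x‖ₑ ∂(σ k) ≤ J k) :
    IsStationarySuperposition hℓ (ρ : Measure E) b ζ := by
  have hmarginal (t : Set.Icc (0 : ℝ) ℓ) : (ζ : Measure (Curve ℓ E)).map (fun γ => γ t) = ρ := by
    have hmap := FiniteMeasure.tendsto_map_of_tendsto_of_continuous η ζ hη
      (continuous_eval_const (F := Curve ℓ E) t)
    have heq : (fun k => (η k).map fun γ => γ t) = σ :=
      funext fun k => Subtype.ext ((hηV k).map_eval t)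
    have hmap_eq : ζ.map (fun γ => γ t) = ρ := tendsto_nhds_unique (heq ▸ hmap) hσ
    exact congrArg FiniteMeasure.toMeasure hmap_eq
  refine ⟨hmarginal, ae_isIntegralSolution_of_forall_ae hℓ hmarginal hb hbρ fun t => ?_⟩
  have hdefect_le (δ : ℝ≥0∞) (hδ : 0 < δ) :
      ∫⁻ γ, ‖solutionDefect hℓ b t γ‖ₑ ∂ζ ≤ ENNReal.ofReal ℓ * δ + ENNReal.ofReal ℓ * δ := by
    obtain ⟨c, hcs, hcδ, hc, hcρ⟩ := hbρ.exists_hasCompactSupport_lintegral_sub_le hδ.ne'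
    obtain ⟨J, hJ, hVJ⟩ := hVb c hc hcs
    have hcm := hc.stronglyMeasurable
    calc ∫⁻ γ, ‖solutionDefect hℓ b t γ‖ₑ ∂ζ
        ≤ ∫⁻ γ, ‖solutionDefect hℓ b t γ - solutionDefect hℓ c t γ‖ₑ +
            ‖solutionDefect hℓ c t γ‖ₑ ∂ζ :=
          lintegral_mono fun γ => by
            simpa using enorm_add_le (solutionDefect hℓ b t γ - solutionDefect hℓ c t γ)
              (solutionDefect hℓ c t γ)
      _ = ∫⁻ γ, ‖solutionDefect hℓ b t γ - solutionDefect hℓ c t γ‖ₑ ∂ζ +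
            ∫⁻ γ, ‖solutionDefect hℓ c t γ‖ₑ ∂ζ :=
          lintegral_add_right _ (measurable_solutionDefect hℓ hcm t).enorm
      _ ≤ ENNReal.ofReal ℓ * δ + ENNReal.ofReal ℓ * δ := by
          refine add_le_add ?_ ?_
          · grw [lintegral_enorm_solutionDefect_sub_le hℓ hmarginal hb hcm hbρ hcρ t, hcδ]
          · grw [lintegral_enorm_solutionDefect_le_of_tendsto hℓ hη hV hVσ hηV hc hcs hJ hVJ t, hcδ]
  have hzero : ∫⁻ γ, ‖solutionDefect hℓ b t γ‖ₑ ∂ζ = 0 := by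
    refine le_antisymm (ge_of_tendsto (x := 𝓝[>] (0 : ℝ≥0∞)) ?_
      (eventually_mem_nhdsWithin.mono hdefect_le)) zero_le
    have hcont : Continuous fun δ : ℝ≥0∞ => ENNReal.ofReal ℓ * δ + ENNReal.ofReal ℓ * δ := by
      fun_prop (disch := exact ENNReal.ofReal_ne_top)
    simpa using (hcont.tendsto 0).mono_left nhdsWithin_le_nhds
  rw [lintegral_eq_zero_iff (measurable_solutionDefect hℓ hb t).enorm] at hzero
  exact hzero.mono fun γ hγ => enorm_eq_zero.1 hγ

end Limit

theorem exists_tendsto_of_isTightMeasureSet {Y ι : Type*} [TopologicalSpace Y] [T2Space Y]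
    [NormalSpace Y] [MeasurableSpace Y] [BorelSpace Y] {η : ι → FiniteMeasure Y} {M : ℝ≥0}
    (hM : ∀ k, (η k).mass ≤ M) (hη : IsTightMeasureSet (Set.range fun k => (η k : Measure Y)))
    (𝒰 : Ultrafilter ι) : ∃ ζ, Tendsto η 𝒰 (𝓝 ζ) := by
  have hu : Tendsto (fun N : ℕ => 1 / ((N : ℝ≥0) + 1)) atTop (𝓝 0) :=
    tendsto_one_div_add_atTop_nhds_zero_nat
  choose K hK hηK using fun N : ℕ => isTightMeasureSet_iff_exists_isCompact_measure_compl_le.1 hη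
    ((1 / ((N : ℝ≥0) + 1) : ℝ≥0) : ℝ≥0∞) (by positivity)
  obtain ⟨ζ, -, hζ⟩ := (isCompact_setOfPred_finiteMeasure_mass_le_compl_isCompact_le M hu hK
    (Or.inl inferInstance)).ultrafilter_le_nhds' (𝒰.map η) (Ultrafilter.mem_map.2
      (Filter.univ_mem' fun k => ⟨hM k, fun N => by
        rw [← ENNReal.coe_le_coe, FiniteMeasure.ennreal_coeFn_eq_coeFn_toMeasure]
        exact hηK N _ (Set.mem_range_self k)⟩))
  exact ⟨ζ, hζ⟩

theorem isTightMeasureSet_range_map {S X Y : Type*} [TopologicalSpace S] [CompactSpace S]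
    [TopologicalSpace X] [MeasurableSpace X] [OpensMeasurableSpace X] [TopologicalSpace Y]
    [T2Space Y] [MeasurableSpace Y] [BorelSpace Y] {μ : Measure X}
    (hμ : IsTightMeasureSet {μ}) {f : S → X → Y} (hf : Continuous fun p : S × X => f p.1 p.2) :
    IsTightMeasureSet (Set.range fun s => μ.map (f s)) := by
  rw [isTightMeasureSet_iff_exists_isCompact_measure_compl_le] at hμ ⊢
  intro δ hδ
  obtain ⟨K, hK, hμK⟩ := hμ δ hδ
  have hcompact : IsCompact ((fun p : S × X => f p.1 p.2) '' Set.univ ×ˢ K) :=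
    (isCompact_univ.prod hK).image hf
  refine ⟨_, hcompact, Set.forall_mem_range.2 fun s => ?_⟩
  have hfs : Continuous (f s) := hf.comp (.prodMk_right s)
  rw [Measure.map_apply hfs.measurable hcompact.measurableSet.compl]
  exact le_trans (measure_mono fun x hx hxK => hx ⟨(s, x), ⟨trivial, hxK⟩, rfl⟩) (hμK μ rfl)

section Dilation

variable [SecondCountableTopology E] {ρ κ : Measure E}

theorem conv_map_smul [SFinite ρ] [SFinite κ] (ε : ℝ) :
    ρ.conv (κ.map fun x => ε • x) = (ρ.prod κ).map fun p => p.1 + ε • p.2 := by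
  have hsmul : Measurable fun x : E => ε • x := measurable_const_smul ε
  have hprod := Measure.map_prod_map ρ κ measurable_id hsmul
  rw [Measure.map_id] at hprod
  rw [Measure.conv, hprod, Measure.map_map measurable_add (measurable_id.prodMap hsmul)]
  rfl

theorem isTightMeasureSet_conv_map_smul [CompleteSpace E] [IsFiniteMeasure ρ] [IsFiniteMeasure κ] :
    IsTightMeasureSet (Set.range fun ε : Set.Icc (0 : ℝ) 1 => ρ.conv (κ.map fun x => ε.1 • x)) := by
  simp only [conv_map_smul]
  exact isTightMeasureSet_range_map isTightMeasureSet_singleton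
    (f := fun (ε : Set.Icc (0 : ℝ) 1) (p : E × E) => p.1 + ε.1 • p.2) (by fun_prop)

variable {ι : Type*} {F : Filter ι} [F.IsCountablyGenerated] {ε : ι → ℝ} (hε : Tendsto ε F (𝓝 0))
include hε

theorem tendsto_of_eq_conv_map_smul {ρ : FiniteMeasure E} [IsProbabilityMeasure κ]
    {σ : ι → FiniteMeasure E}
    (hσ : ∀ k, (σ k : Measure E) = (ρ : Measure E).conv (κ.map fun x => ε k • x)) :
    Tendsto σ F (𝓝 ρ) := by
  refine FiniteMeasure.tendsto_iff_forall_integral_tendsto.2 fun g => ?_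
  have hshift (k : ι) : Measurable fun p : E × E => p.1 + ε k • p.2 := by fun_prop
  have hlim : ∫ x, g x ∂(ρ : Measure E) = ∫ p, g p.1 ∂(ρ : Measure E).prod κ := by
    rw [integral_fun_fst, probReal_univ, one_smul]
  simp only [hlim, hσ, conv_map_smul,
    integral_map (hshift _).aemeasurable g.continuous.aestronglyMeasurable]
  refine tendsto_integral_filter_of_dominated_convergence (fun _ => ‖g‖)
    (.of_forall fun k => (g.continuous.measurable.comp (hshift k)).aestronglyMeasurable)
    (.of_forall fun k => ae_of_all _ fun p => g.norm_coe_le_norm _) (integrable_const _)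
    (ae_of_all _ fun p => (g.continuous.tendsto _).comp ?_)
  simpa using tendsto_const_nhds.add (hε.smul_const p.2)

theorem tendsto_lintegral_enorm_sub_comp_add_smul [IsFiniteMeasure ρ] [IsProbabilityMeasure κ]
    (hb : StronglyMeasurable b) (hbρ : Integrable b ρ) (hc : Continuous c)
    (hcs : HasCompactSupport c) :
    Tendsto (fun k => ∫⁻ z, ∫⁻ y, ‖b z - c (z + ε k • y)‖ₑ ∂κ ∂ρ) F
      (𝓝 (∫⁻ z, ‖b z - c z‖ₑ ∂ρ)) := by
  obtain ⟨A, hA⟩ := hc.bounded_above_of_compact_support hcs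
  have hbm := hb.measurable
  have hcm := hc.measurable
  have hmeas (a : ℝ) : Measurable fun p : E × E => ‖b p.1 - c (p.1 + a • p.2)‖ₑ := by fun_prop
  have hlim : ∫⁻ z, ‖b z - c z‖ₑ ∂ρ = ∫⁻ p, ‖b p.1 - c p.1‖ₑ ∂(ρ.prod κ) := by
    rw [lintegral_prod _ (by fun_prop)]
    simp only [lintegral_const, measure_univ, mul_one]
  simp only [hlim, ← fun a => lintegral_prod (μ := ρ) (ν := κ) _ (hmeas a).aemeasurable]
  refine tendsto_lintegral_filter_of_dominated_convergence (fun p => ‖b p.1‖ₑ + ENNReal.ofReal A)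
    (.of_forall fun k => hmeas (ε k)) (.of_forall fun k => ae_of_all _ fun p => ?_) ?_
    (ae_of_all _ fun p => ?_)
  · refine enorm_sub_le.trans (add_le_add_right ?_ _)
    rw [← ofReal_norm]
    exact ENNReal.ofReal_le_ofReal (hA _)
  · rw [lintegral_add_right _ measurable_const, lintegral_const]
    exact ENNReal.add_ne_top.2 ⟨(hbρ.comp_fst κ).2.ne,
      ENNReal.mul_ne_top ENNReal.ofReal_ne_top (measure_ne_top _ _)⟩
  · refine (continuous_enorm.tendsto _).comp (tendsto_const_nhds.sub ((hc.tendsto _).comp ?_))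
    simpa using tendsto_const_nhds.add (hε.smul_const p.2)

end Dilation

theorem exists_tendsto_of_isStationarySuperposition [FiniteDimensional ℝ E] {ι : Type*}
    {η : ι → FiniteMeasure (Curve ℓ E)} {σ : ι → FiniteMeasure E} {M : ℝ≥0}
    (hσM : ∀ k, (σ k).mass ≤ M) (hσ : IsTightMeasureSet (Set.range fun k => (σ k : Measure E)))
    {V : ι → E → E} (hV : ∀ k, StronglyMeasurable (V k)) (hV1 : ∀ k x, ‖V k x‖ ≤ 1)
    (hη : ∀ k, IsStationarySuperposition hℓ (σ k : Measure E) (V k) (η k)) (𝒰 : Ultrafilter ι) :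
    ∃ ζ, Tendsto η 𝒰 (𝓝 ζ) := by
  let t₀ : Set.Icc (0 : ℝ) ℓ := ⟨0, Set.left_mem_Icc.2 hℓ⟩
  have hmass (k : ι) : (η k).mass ≤ M := by
    refine le_trans (ENNReal.coe_le_coe.1 ?_) (hσM k)
    rw [FiniteMeasure.ennreal_mass, FiniteMeasure.ennreal_mass, ← (hη k).map_eval t₀,
      Measure.map_apply (Curve.measurable_eval t₀) MeasurableSet.univ, Set.preimage_univ]
  refine exists_tendsto_of_isTightMeasureSet hmass
    (Curve.isTightMeasureSet_of_ae_lipschitzWith_one t₀ ?_ ?_) 𝒰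
  · rintro _ ⟨k, rfl⟩
    exact (hη k).ae_isIntegralSolution.mono fun γ hγ => hγ.lipschitzWith_one hℓ (hV k) (hV1 k)
  · refine hσ.subset ?_
    rintro _ ⟨_, ⟨k, rfl⟩, rfl⟩
    exact ⟨k, ((hη k).map_eval t₀).symm⟩

theorem exists_isStationarySuperposition [FiniteDimensional ℝ E] (ρ : Measure E)
    [IsFiniteMeasure ρ] (hb : StronglyMeasurable b) (hb1 : ∀ᵐ x ∂ρ, ‖b x‖ ≤ 1)
    (hdiv : IsDivFree ρ b) : ∃ ζ, IsStationarySuperposition hℓ ρ b ζ := by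
  rcases eq_zero_or_neZero ρ with rfl | hρ
  · exact ⟨0, fun t => Measure.map_zero _, by simp⟩
  obtain ⟨κ, hκ, hmollify⟩ := exists_mollification ρ hb hb1 hdiv
  let ε : ℕ → ℝ := fun k => 1 / ((k : ℝ) + 1)
  have hε0 (k : ℕ) : 0 < ε k := Nat.one_div_pos_of_nat
  have hε : Tendsto ε atTop (𝓝 0) := tendsto_one_div_add_atTop_nhds_zero_nat
  have hbρ : Integrable b ρ := .of_bound hb.aestronglyMeasurable 1 hb1
  choose V L hVL hV1 hac hVdiv hVc using fun k => hmollify (ε k) (hε0 k)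
  choose X hX using fun k => exists_isFlowOn (hVL k) (hV1 k) (T := ℓ + 1) (by linarith)
  choose η hη using fun k => (hX k).exists_isStationarySuperposition hℓ (lt_add_one ℓ) (hVL k)
    (hV1 k) (hac k) (hVdiv k)
  have hVm (k : ℕ) : StronglyMeasurable (V k) := (hVL k).continuous.stronglyMeasurable
  let σ : ℕ → FiniteMeasure E := fun k => ⟨ρ.conv (κ.map fun x => ε k • x), inferInstance⟩
  let η' : ℕ → FiniteMeasure (Curve ℓ E) := fun k => ⟨η k, (hη k).isFiniteMeasure⟩
  have hσ : Tendsto σ atTop (𝓝 ⟨ρ, inferInstance⟩) := tendsto_of_eq_conv_map_smul hε fun _ => rfl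
  have hσtight : IsTightMeasureSet (Set.range fun k => (σ k : Measure E)) := by
    refine (isTightMeasureSet_conv_map_smul (ρ := ρ) (κ := κ)).subset ?_
    rintro _ ⟨k, rfl⟩
    exact ⟨⟨ε k, (hε0 k).le, div_le_one_of_le₀ (by simp) (by positivity)⟩, rfl⟩
  obtain ⟨M, hσM⟩ := hσ.mass.bddAbove_range
  obtain ⟨ζ, hζ⟩ := exists_tendsto_of_isStationarySuperposition hℓ (η := η') (σ := σ)
    (Set.forall_mem_range.1 hσM) hσtight hVm hV1 hη (hyperfilter ℕ)
  refine ⟨ζ, .of_tendsto hℓ hζ (σ := σ) hVm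
    (fun k => .of_bound (hVm k).aestronglyMeasurable 1 (ae_of_all _ (hV1 k))) hη
    (hσ.mono_left Nat.hyperfilter_le_atTop) hb hbρ fun c hc hcs =>
      ⟨_, ?_, fun k => hVc k c hc.stronglyMeasurable⟩⟩
  exact (tendsto_lintegral_enorm_sub_comp_add_smul hε hb hbρ hc hcs).mono_left
    Nat.hyperfilter_le_atTop

end Superposition

section Charges

variable {n : ℕ} {μ : Charge n} {ρ : Measure (EuclideanSpace ℝ (Fin n))}
  {b φ : EuclideanSpace ℝ (Fin n) → EuclideanSpace ℝ (Fin n)}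

theorem Charge.integrable_variation (μ : Charge n) (hφ : Continuous φ)
    (hφs : HasCompactSupport φ) : VectorMeasure.Integrable μ φ := by
  obtain ⟨A, hA⟩ := hφ.bounded_above_of_compact_support hφs
  exact .of_bound hφ.aestronglyMeasurable A (ae_of_all _ hA)

theorem integrable_inner_of_hasCompactSupport (hb : Integrable b ρ) (hφ : Continuous φ)
    (hφs : HasCompactSupport φ) : Integrable (fun x => inner ℝ (φ x) (b x)) ρ :=
  integrable_bilin_of_integrable_withDensityᵥ (innerSL ℝ) hb
    (Charge.integrable_variation _ hφ hφs)

theorem Charge.act_withDensityᵥ (hb : Integrable b ρ) (hφ : Continuous φ)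
    (hφs : HasCompactSupport φ) :
    Charge.act (ρ.withDensityᵥ b) φ = ∫ x, inner ℝ (φ x) (b x) ∂ρ :=
  integral_withDensityᵥ (innerSL ℝ) hb (Charge.integrable_variation _ hφ hφs)

theorem IsDivFree.smul_measure (h : IsDivFree ρ b) (a : ℝ≥0∞) : IsDivFree (a • ρ) b :=
  fun ψ hψ hψs => by rw [integral_smul_measure, h ψ hψ hψs, smul_zero]

theorem Charge.DivergenceFree.isDivFree (hμ : μ.DivergenceFree) (hb : Integrable b ρ)
    (hμb : μ = ρ.withDensityᵥ b) : IsDivFree ρ b := by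
  intro ψ hψ hψs
  have hgrad : Continuous (gradient ψ) :=
    (InnerProductSpace.toDual ℝ (EuclideanSpace ℝ (Fin n))).symm.continuous.comp
      (hψ.continuous_fderiv (by simp))
  have hgrads : HasCompactSupport (gradient ψ) := (hψs.fderiv ℝ).comp_left (map_zero _)
  have hact := neg_eq_zero.1 (hμ ψ hψ hψs)
  rw [hμb, Charge.act_withDensityᵥ hb hgrad hgrads] at hact
  simpa only [gradient, InnerProductSpace.toDual_symm_apply] using hact

end Charges

section CurveCharges

variable {n : ℕ} {ℓ : ℝ} (hℓ : 0 < ℓ) {γ : Curve ℓ (EuclideanSpace ℝ (Fin n))}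
  {b : EuclideanSpace ℝ (Fin n) → EuclideanSpace ℝ (Fin n)}

theorem mem_lipCurves_of_lipschitzWith_one (hγ : LipschitzWith 1 γ) : γ ∈ lipCurves n hℓ := by
  refine ⟨⟨1, hγ⟩, ae_of_all _ fun t => ?_⟩
  have hext : LipschitzWith (1 * 1) (curveExt hℓ γ) := hγ.comp (.projIcc hℓ.le)
  simpa [velocity] using norm_deriv_le_of_lipschitz hext

theorem ae_comp_curveExt {p : EuclideanSpace ℝ (Fin n) → Prop}
    (hp : ∀ᵐ x ∂Curve.occupation hℓ.le γ, p x) :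
    ∀ᵐ t ∂volume.restrict (Set.Icc 0 ℓ), p (curveExt hℓ γ t) :=
  ae_of_ae_map (Curve.continuous_IccExtend hℓ.le γ).aemeasurable hp

section IsIntegralSolution

variable (hγ : IsIntegralSolution hℓ.le b γ) (hb : StronglyMeasurable b)
  (hbγ : Integrable b (Curve.occupation hℓ.le γ))
include hγ hb hbγ

theorem IsIntegralSolution.velocity_ae_eq :
    ∀ᵐ t ∂volume.restrict (Set.Icc 0 ℓ), velocity hℓ γ t = b (curveExt hℓ γ t) := by
  have h0 : (0 : ℝ) ∈ Set.Icc 0 ℓ := Set.left_mem_Icc.2 hℓ.le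
  have hint := Curve.intervalIntegrable_of_integrable_occupation hℓ.le hb hbγ h0
    (Set.right_mem_Icc.2 hℓ.le)
  rw [← restrict_Ioo_eq_restrict_Icc, ae_restrict_iff' measurableSet_Ioo]
  filter_upwards [hint.ae_hasDerivAt_integral] with t hderiv ht
  have hprim := (hderiv (Set.uIcc_of_le hℓ.le ▸ Set.Ioo_subset_Icc_self ht) 0
    Set.left_mem_uIcc).const_add (γ ⟨0, h0⟩)
  refine HasDerivAt.deriv (hprim.congr_of_eventuallyEq ?_)
  filter_upwards [Ioo_mem_nhds ht.1 ht.2] with s hs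
  have hs' := Set.Ioo_subset_Icc_self hs
  rw [← sub_eq_zero.1 (hγ ⟨s, hs'⟩), add_sub_cancel, curveExt, Set.IccExtend_of_mem _ _ hs']

theorem IsIntegralSolution.curveCharge_eq :
    curveCharge hℓ γ = (Curve.occupation hℓ.le γ).withDensityᵥ b := by
  have hmeas : Measurable (curveExt hℓ γ) := (Curve.continuous_IccExtend hℓ.le γ).measurable
  have hocc : Curve.occupation hℓ.le γ = (volume.restrict (Set.Icc 0 ℓ)).map (curveExt hℓ γ) := rfl
  have hint : Integrable (fun t => b (curveExt hℓ γ t)) (volume.restrict (Set.Icc 0 ℓ)) :=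
    (Curve.integrable_occupation_iff hℓ.le hb).1 hbγ
  rw [curveCharge, WithDensityᵥEq.congr_ae (hγ.velocity_ae_eq hℓ hb hbγ)]
  ext1 A hA
  rw [VectorMeasure.map_apply _ hmeas hA, withDensityᵥ_apply hint (hmeas hA),
    withDensityᵥ_apply hbγ hA, hocc,
    setIntegral_map hA hb.aestronglyMeasurable hmeas.aemeasurable]

variable (hbγ1 : ∀ᵐ x ∂Curve.occupation hℓ.le γ, ‖b x‖ = 1)
include hbγ1

theorem IsIntegralSolution.variation_curveCharge :
    (curveCharge hℓ γ).variation = Curve.occupation hℓ.le γ := by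
  rw [hγ.curveCharge_eq hℓ hb hbγ,
    variation_withDensityᵥ_of_norm_eq_one hb.aestronglyMeasurable hbγ1]

theorem IsIntegralSolution.curveLength_eq : curveLength hℓ γ = ENNReal.ofReal ℓ := by
  have hspeed : ∀ᵐ t ∂volume.restrict (Set.Icc 0 ℓ), ‖velocity hℓ γ t‖ₑ = 1 := by
    filter_upwards [hγ.velocity_ae_eq hℓ hb hbγ, ae_comp_curveExt hℓ hbγ1] with t hvel hnorm
    rw [hvel, ← ofReal_norm, hnorm, ENNReal.ofReal_one]
  rw [curveLength, lintegral_congr_ae hspeed, setLIntegral_one, Real.volume_Icc, sub_zero]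

end IsIntegralSolution

end CurveCharges

section MeasureIntegral

variable {X Y : Type*} [MeasurableSpace X] [MeasurableSpace Y] {ν : Measure Y}

theorem exists_measure_subtype_map_eq {s : Set Y} (hs : ∀ᵐ y ∂ν, y ∈ s) :
    ∃ ν' : Measure s, ν'.map Subtype.val = ν := by
  have hs' : NullMeasurableSet s ν := .of_compl (.of_null hs)
  refine ⟨ν.comap Subtype.val, Measure.ext fun A hA => ?_⟩
  rw [Measure.map_apply measurable_subtype_coe hA, Measure.comap_apply₀ _ _ Subtype.coe_injective
    (fun _ => Measure.MeasurableSet.nullMeasurableSet_subtype_coe hs')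
    (measurable_subtype_coe hA).nullMeasurableSet, Set.image_preimage_eq_inter_range,
    Subtype.range_coe, Set.inter_comm, Measure.measure_inter_eq_of_ae hs]

theorem integrable_and_integral_bind {F : Type*} [NormedAddCommGroup F] [NormedSpace ℝ F]
    {κ : ProbabilityTheory.Kernel Y X} {f : X → F} (hf : Integrable f (ν.bind κ)) :
    Integrable (fun y => ∫ x, f x ∂κ y) ν ∧ ∫ x, f x ∂ν.bind κ = ∫ y, ∫ x, f x ∂κ y ∂ν := by
  rw [Measure.comp_eq_comp_const_apply] at hf ⊢
  exact ⟨hf.integral_comp, ProbabilityTheory.Kernel.integral_comp hf⟩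

theorem isMeasureIntegral_bind {κ : Y → Measure X} (hκ : AEMeasurable κ ν) :
    IsMeasureIntegral (ν.bind κ) κ ν :=
  fun _ hE => ⟨(Measure.measurable_coe hE).comp_aemeasurable hκ, Measure.bind_apply hE hκ⟩

theorem isMeasureIntegral_dirac_comp {f : Y → X} (hf : Measurable f) :
    IsMeasureIntegral (ν.map f) (fun y => Measure.dirac (f y)) ν := by
  rw [← Measure.bind_dirac_eq_map ν hf]
  exact isMeasureIntegral_bind (Measure.measurable_dirac.comp hf).aemeasurable

theorem IsMeasureIntegral.comp {Z : Type*} [MeasurableSpace Z] {ρ : Measure X} {κ : Y → Measure X}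
    {f : Z → Y} {ν : Measure Z} (h : IsMeasureIntegral ρ κ (ν.map f)) (hf : AEMeasurable f ν) :
    IsMeasureIntegral ρ (fun z => κ (f z)) ν := fun E hE =>
  ⟨(h E hE).1.comp_aemeasurable hf, (h E hE).2.trans (lintegral_map' (h E hE).1 hf)⟩

theorem IsMeasureIntegral.smul_measure {ρ : Measure X} {κ : Y → Measure X}
    (h : IsMeasureIntegral ρ κ ν) (a : ℝ≥0∞) : IsMeasureIntegral (a • ρ) κ (a • ν) := fun E hE =>
  ⟨(h E hE).1.smul_measure a, by
    rw [Measure.smul_apply, lintegral_smul_measure, (h E hE).2]⟩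

end MeasureIntegral

section StationarySuperposition

variable {n : ℕ} {ℓ : ℝ} (hℓ : 0 < ℓ) {ρ : Measure (EuclideanSpace ℝ (Fin n))}
  {b : EuclideanSpace ℝ (Fin n) → EuclideanSpace ℝ (Fin n)}
  {ζ : Measure (Curve ℓ (EuclideanSpace ℝ (Fin n)))}
  (hζ : IsStationarySuperposition hℓ.le ρ b ζ)
include hζ

namespace IsStationarySuperposition

theorem isMeasureIntegral_dirac_eval (t : Set.Icc (0 : ℝ) ℓ) :
    IsMeasureIntegral ρ (fun γ => Measure.dirac (γ t)) ζ := by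
  rw [← hζ.map_eval t]
  exact isMeasureIntegral_dirac_comp (Curve.measurable_eval t)

variable (hb : StronglyMeasurable b)
include hb

theorem ae_mem_lipCurves (hb1 : ∀ x, ‖b x‖ ≤ 1) : ∀ᵐ γ ∂ζ, γ ∈ lipCurves n hℓ :=
  hζ.ae_isIntegralSolution.mono fun _ hγ =>
    mem_lipCurves_of_lipschitzWith_one hℓ (hγ.lipschitzWith_one hℓ.le hb hb1)

variable [IsFiniteMeasure ρ]

section Integrable

variable (hbρ : Integrable b ρ)
include hbρ

theorem ae_curveCharge_eq :
    ∀ᵐ γ ∂ζ, curveCharge hℓ γ = (Curve.occupation hℓ.le γ).withDensityᵥ b := by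
  have := hζ.isFiniteMeasure
  filter_upwards [hζ.ae_isIntegralSolution,
    Curve.ae_integrable_occupation hℓ.le hζ.map_eval hbρ] with γ hγ hbγ
  exact hγ.curveCharge_eq hℓ hb hbγ

theorem integral_act_curveCharge {φ : EuclideanSpace ℝ (Fin n) → EuclideanSpace ℝ (Fin n)}
    (hφ : Continuous φ) (hφs : HasCompactSupport φ) :
    Integrable (fun γ => (curveCharge hℓ γ).act φ) ζ ∧
      Charge.act ((ENNReal.ofReal ℓ • ρ).withDensityᵥ b) φ =
        ∫ γ, (curveCharge hℓ γ).act φ ∂ζ := by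
  have := hζ.isFiniteMeasure
  have hbℓ : Integrable b (ENNReal.ofReal ℓ • ρ) := hbρ.smul_measure ENNReal.ofReal_ne_top
  have hint := integrable_inner_of_hasCompactSupport hbℓ hφ hφs
  have hact : ∀ᵐ γ ∂ζ, ∫ x, inner ℝ (φ x) (b x) ∂Curve.occupation hℓ.le γ =
      (curveCharge hℓ γ).act φ := by
    filter_upwards [hζ.ae_curveCharge_eq hℓ hb hbρ,
      Curve.ae_integrable_occupation hℓ.le hζ.map_eval hbρ] with γ hγ hbγ
    rw [hγ, Charge.act_withDensityᵥ hbγ hφ hφs]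
  rw [Charge.act_withDensityᵥ hbℓ hφ hφs]
  rw [← hζ.bind_occupation_eq_smul hℓ.le] at hint ⊢
  obtain ⟨hact_int, hbind⟩ := integrable_and_integral_bind hint
  exact ⟨hact_int.congr hact, hbind.trans (integral_congr_ae hact)⟩

end Integrable

variable (hb1 : ∀ᵐ x ∂ρ, ‖b x‖ = 1)
include hb1

theorem ae_variation_curveCharge_eq :
    ∀ᵐ γ ∂ζ, (curveCharge hℓ γ).variation = Curve.occupation hℓ.le γ := by
  filter_upwards [hζ.ae_isIntegralSolution, hζ.ae_ae_occupation hℓ.le hb1] with γ hγ hγ1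
  exact hγ.variation_curveCharge hℓ hb
    (.of_bound hb.aestronglyMeasurable 1 (hγ1.mono fun x hx => hx.le)) hγ1

theorem ae_curveLength_eq : ∀ᵐ γ ∂ζ, curveLength hℓ γ = ENNReal.ofReal ℓ := by
  filter_upwards [hζ.ae_isIntegralSolution, hζ.ae_ae_occupation hℓ.le hb1] with γ hγ hγ1
  exact hγ.curveLength_eq hℓ hb
    (.of_bound hb.aestronglyMeasurable 1 (hγ1.mono fun x hx => hx.le)) hγ1

theorem isMeasureIntegral_variation_curveCharge :
    IsMeasureIntegral (ENNReal.ofReal ℓ • ρ) (fun γ => (curveCharge hℓ γ).variation) ζ := by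
  have hvar := hζ.ae_variation_curveCharge_eq hℓ hb hb1
  rw [← hζ.bind_occupation_eq_smul hℓ.le, ← Measure.bind_congr_right hvar]
  exact isMeasureIntegral_bind
    ((Curve.occupation hℓ.le).aemeasurable.congr (Filter.EventuallyEq.symm hvar))

end IsStationarySuperposition

end StationarySuperposition

theorem Charge.DivergenceFree.exists_superposition {n : ℕ} {ℓ : ℝ} (hℓ : 0 < ℓ)
    {μ : Charge n} (hμ : μ.DivergenceFree) :
    ∃ (ρ : Measure (EuclideanSpace ℝ (Fin n)))
      (b : EuclideanSpace ℝ (Fin n) → EuclideanSpace ℝ (Fin n))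
      (ζ : Measure (Curve ℓ (EuclideanSpace ℝ (Fin n)))),
      IsFiniteMeasure ρ ∧ ENNReal.ofReal ℓ • ρ = μ.variation ∧ StronglyMeasurable b ∧
      (∀ x, ‖b x‖ ≤ 1) ∧ (∀ᵐ x ∂ρ, ‖b x‖ = 1) ∧ μ = μ.variation.withDensityᵥ b ∧
      IsStationarySuperposition hℓ.le ρ b ζ := by
  obtain ⟨b, hb, hb_le, hb1, hμb⟩ := exists_eq_variation_withDensityᵥ μ
  have hbμ : Integrable b μ.variation := .of_bound hb.aestronglyMeasurable 1 (ae_of_all _ hb_le)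
  have hℓ0 : ENNReal.ofReal ℓ ≠ 0 := (ENNReal.ofReal_pos.2 hℓ).ne'
  have hfinite : IsFiniteMeasure ((ENNReal.ofReal ℓ)⁻¹ • μ.variation) :=
    μ.variation.smul_finite (ENNReal.inv_ne_top.2 hℓ0)
  obtain ⟨ζ, hζ⟩ := exists_isStationarySuperposition hℓ.le
    ((ENNReal.ofReal ℓ)⁻¹ • μ.variation) hb.stronglyMeasurable (ae_of_all _ hb_le)
    ((hμ.isDivFree hbμ hμb).smul_measure _)
  refine ⟨_, b, ζ, hfinite, ?_, hb.stronglyMeasurable, hb_le, Measure.ae_smul_measure hb1 _, hμb,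
    hζ⟩
  rw [smul_smul, ENNReal.mul_inv_cancel hℓ0 ENNReal.ofReal_ne_top, one_smul]

theorem mainTheorem4 (n : ℕ) (ℓ : ℝ) (hℓ : 0 < ℓ) (μ : Charge n) (hμ : μ.DivergenceFree) :
    ∃ ν : Measure (lipCurves n hℓ), IsFiniteMeasure ν ∧
      IsChargeIntegral hℓ μ ν ∧
      IsMeasureIntegral μ.variation (fun γ => (curveCharge hℓ γ.1).variation) ν ∧
      (∀ᵐ γ ∂ν, (∀ t : Set.Icc (0 : ℝ) ℓ, γ.1 t ∈ μ.supp) ∧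
        (curveCharge hℓ γ.1).variation Set.univ = curveLength hℓ γ.1 ∧
        curveLength hℓ γ.1 = ENNReal.ofReal ℓ) ∧
      IsMeasureIntegral μ.variation
        (fun γ => Measure.dirac (γ.1 ⟨0, Set.left_mem_Icc.2 hℓ.le⟩)) (ENNReal.ofReal ℓ • ν) ∧
      IsMeasureIntegral μ.variation
        (fun γ => Measure.dirac (γ.1 ⟨ℓ, Set.right_mem_Icc.2 hℓ.le⟩)) (ENNReal.ofReal ℓ • ν) := by
  obtain ⟨ρ, b, ζ, hfinite, hρ, hb, hb_le, hb1, hμb, hζ⟩ := hμ.exists_superposition hℓ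
  obtain ⟨ν, rfl⟩ := exists_measure_subtype_map_eq (hζ.ae_mem_lipCurves hℓ hb hb_le)
  have hval : AEMeasurable Subtype.val ν := measurable_subtype_coe.aemeasurable
  have hζ_finite := hζ.isFiniteMeasure
  have hsupp : ∀ᵐ x ∂ρ, x ∈ μ.supp := by
    rw [← Measure.ae_ennreal_smul_measure_eq (ENNReal.ofReal_pos.2 hℓ).ne' ρ, hρ]
    exact Measure.support_mem_ae
  have hbρ : Integrable b ρ := .of_bound hb.aestronglyMeasurable 1 (ae_of_all _ hb_le)
  rw [← hρ]
  refine ⟨ν, Measure.isFiniteMeasure_of_map hval, fun φ hφ hφs => ?_,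
    (hζ.isMeasureIntegral_variation_curveCharge hℓ hb hb1).comp hval, ?_,
    ((hζ.isMeasureIntegral_dirac_eval hℓ _).comp hval).smul_measure _,
    ((hζ.isMeasureIntegral_dirac_eval hℓ _).comp hval).smul_measure _⟩
  · obtain ⟨hint, hact⟩ := hζ.integral_act_curveCharge hℓ hb hbρ hφ hφs
    rw [integral_map hval hint.aestronglyMeasurable, hρ, ← hμb] at hact
    exact ⟨hint.comp_aemeasurable hval, hact⟩
  · filter_upwards [ae_of_ae_map hval (hζ.ae_forall_apply_mem hℓ.le Measure.isClosed_support hsupp),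
      ae_of_ae_map hval (hζ.ae_variation_curveCharge_eq hℓ hb hb1),
      ae_of_ae_map hval (hζ.ae_curveLength_eq hℓ hb hb1)] with γ hγ hvar hlen
    exact ⟨hγ, by rw [hvar, hlen, Curve.occupation_univ], hlen⟩
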